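/- Let $n,p,m\ge 0$ be integers with $n>p+1$ and $n>p-m+2$. Let $X$ be a random $n\times p$ matrix whose rows $x_1,\dots,x_n$ are i.i.d. $N(0,\Sigma_0)$ with $\Sigma_0$ positive definite, and let $y=X\beta_0+\epsilon$, where $\beta_0\in\mathbb R^p$ and $\epsilon$ is independent of $X$ with i.i.d. $N(0,\sigma_0^2)$ entries, $\sigma_0^2>0$. Let $R\in\mathbb R^{m\times p}$ have rank $m$, let $r\in\mathbb R^m$, and assume that the true model satisfies the restrictions, $R\beta_0=r$. For $\beta\in\mathbb R^p$, $\sigma^2>0$ and $\Sigma$ positive definite, let $f(y,X\mid\beta,\sigma^2,\Sigma)$ be the density of a sample of size $n$ with rows of $X$ i.i.d. $N(0,\Sigma)$ and $y\mid X\sim N(X\beta,\sigma^2 I_n)$: $$-2\log f(y,X\mid\beta,\sigma^2,\Sigma)=n\log(2\pi\sigma^2)+\frac{\|y-X\beta\|_2^2}{\sigma^2}+np\log(2\pi)+n\log|\Sigma|+\sum_{i=1}^n x_i^T\Sigma^{-1}x_i .$$ Then almost surely there is exactly one joint maximum likelihood estimator $(\hat\beta,\hat\sigma^2,\hat\Sigma)$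 subject to $R\beta=r$, namely $$\hat\beta=\hat\beta^f+(X^TX)^{-1}R^T\big(R(X^TX)^{-1}R^T\big)^{-1}(r-R\hat\beta^f),\qquad \hat\sigma^2=\tfrac1n\mathrm{RSS}(R,r),\qquad \hat\Sigma=\tfrac1n X^TX,$$ where $\hat\beta^f=(X^TX)^{-1}X^Ty$ and $\mathrm{RSS}(R,r)=\|y-X\hat\beta\|_2^2$. Let $(X^{(n)},y^{(n)})$ be an independent copy of $(X,y)$, and let $$\mathrm{errR}=-2\log f(y,X\mid\hat\beta,\hat\sigma^2,\hat\Sigma),\qquad \mathrm{ErrR}=E_{X^{(n)},y^{(n)}}\big[-2\log f(y^{(n)},X^{(n)}\mid\hat\beta,\hat\sigma^2,\hat\Sigma)\big],\qquad \mathrm{optR}=\mathrm{ErrR}-\mathrm{errR}$$ be the Kullback--Leibler training error, test error and optimism; in $\mathrm{ErrR}$ the expectation is over the new sample only. All expectations here are finite, and $$E_{X,y}(\mathrm{optR})=n\,\frac{n(n-1)}{(n-p+m-2)(n-p+m-1)}+n\,\frac{np}{n-p-1}-n(p+1).$$ Consequently, with $$\mathrm{RAICc}(R,r)=n\log\frac{\mathrm{RSS}(R,r)}{n}+n\,\frac{n(n-1)}{(n-p+m-2)(n-p+m-1)},$$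 almost surely $$\mathrm{errR}+E_{X,y}(\mathrm{optR})=\mathrm{RAICc}(R,r)+n(p+1)\log(2\pi)+n\,\frac{np}{n-p-1}+n\log|\hat\Sigma| ,$$ where the last three terms do not depend on the restrictions, and this quantity is an unbiased estimator of $E_{X,y}(\mathrm{ErrR})$. -/

import Mathlib

open MeasureTheory ProbabilityTheory
open scoped Matrix

noncomputable section

namespace RandomX

/-- The parameters `(β, σ², Σ)` of the joint Gaussian model for `(y, X)`. -/
@[ext]
structure Params (p : ℕ) where
  β : Fin p → ℝ
  var : ℝ
  cov : Matrix (Fin p) (Fin p) ℝ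

variable {n p m : ℕ}

/-- The design: the rows `x i` are i.i.d. `N(0, S)`, the errors `ε i` are i.i.d. `N(0, v)`, and
the vector of errors is independent of the design matrix. -/
structure IsGaussianDesign {Ω : Type*} [MeasurableSpace Ω] (P : Measure Ω)
    (x : Fin n → Ω → EuclideanSpace ℝ (Fin p)) (ε : Fin n → Ω → ℝ)
    (S : Matrix (Fin p) (Fin p) ℝ) (v : ℝ) : Prop where
  law_row : ∀ i, HasLaw (x i) (multivariateGaussian 0 S) P
  indep_rows : iIndepFun x P
  law_err : ∀ i, HasLaw (ε i) (gaussianReal 0 v.toNNReal) P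
  indep_errs : iIndepFun ε P
  indep : IndepFun (fun ω i => x i ω) (fun ω i => ε i ω) P

/-- The random `n × p` design matrix with rows `x i`. -/
def design {Ω : Type*} (x : Fin n → Ω → EuclideanSpace ℝ (Fin p)) (ω : Ω) :
    Matrix (Fin n) (Fin p) ℝ :=
  Matrix.of fun i j => x i ω j

/-- The response `y = X β₀ + ε`. -/
def response {Ω : Type*} (x : Fin n → Ω → EuclideanSpace ℝ (Fin p)) (ε : Fin n → Ω → ℝ)
    (β₀ : Fin p → ℝ) (ω : Ω) : Fin n → ℝ :=
  fun i => (design x ω *ᵥ β₀) i + ε i ω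

/-- The density of `N(0, S)` on `ℝᵖ`. -/
def rowDensity (S : Matrix (Fin p) (Fin p) ℝ) (x : Fin p → ℝ) : ℝ :=
  (√((2 * Real.pi) ^ p * S.det))⁻¹ * Real.exp (-(x ⬝ᵥ (S⁻¹ *ᵥ x)) / 2)

/-- The joint density of one observation `(y, x)`: the conditional density of `y` given `x`, which
is that of `N(xᵀβ, σ²)`, times the marginal density of `x`. -/
def obsDensity (θ : Params p) (y : ℝ) (x : Fin p → ℝ) : ℝ :=
  gaussianPDFReal (x ⬝ᵥ θ.β) θ.var.toNNReal y * rowDensity θ.cov x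

/-- `-2 log f(y, X | β, σ², Σ)` for a sample of `n` independent observations. -/
def negTwoLogLik (X : Matrix (Fin n) (Fin p) ℝ) (y : Fin n → ℝ) (θ : Params p) : ℝ :=
  -2 * Real.log (∏ i, obsDensity θ (y i) (X i))

/-- The parameters of the approximating model under the restrictions `R β = r`. -/
def restrictedParams (R : Matrix (Fin m) (Fin p) ℝ) (r : Fin m → ℝ) : Set (Params p) :=
  {θ | R *ᵥ θ.β = r ∧ 0 < θ.var ∧ θ.cov.PosDef}

/-- `θ` is a joint maximum likelihood estimate under the restrictions `R β = r`. -/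
def IsRestrictedMLE (R : Matrix (Fin m) (Fin p) ℝ) (r : Fin m → ℝ)
    (X : Matrix (Fin n) (Fin p) ℝ) (y : Fin n → ℝ) (θ : Params p) : Prop :=
  θ ∈ restrictedParams R r ∧ IsMinOn (negTwoLogLik X y) (restrictedParams R r) θ

/-- The unrestricted least squares estimator `(XᵀX)⁻¹ Xᵀ y`. -/
def betaFull (X : Matrix (Fin n) (Fin p) ℝ) (y : Fin n → ℝ) : Fin p → ℝ :=
  (Xᵀ * X)⁻¹ *ᵥ (Xᵀ *ᵥ y)

/-- The restricted least squares estimator. -/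
def betaHat (R : Matrix (Fin m) (Fin p) ℝ) (r : Fin m → ℝ)
    (X : Matrix (Fin n) (Fin p) ℝ) (y : Fin n → ℝ) : Fin p → ℝ :=
  betaFull X y +
    ((Xᵀ * X)⁻¹ * Rᵀ * (R * (Xᵀ * X)⁻¹ * Rᵀ)⁻¹) *ᵥ (r - R *ᵥ betaFull X y)

/-- The residual sum of squares `RSS(R, r) = ‖y - X β̂‖²`. -/
def rss (R : Matrix (Fin m) (Fin p) ℝ) (r : Fin m → ℝ)
    (X : Matrix (Fin n) (Fin p) ℝ) (y : Fin n → ℝ) : ℝ :=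
  ∑ i, (y i - (X *ᵥ betaHat R r X y) i) ^ 2

/-- The closed form of the joint restricted MLE `(β̂, σ̂², Σ̂)`. -/
def mle (R : Matrix (Fin m) (Fin p) ℝ) (r : Fin m → ℝ)
    (X : Matrix (Fin n) (Fin p) ℝ) (y : Fin n → ℝ) : Params p where
  β := betaHat R r X y
  var := rss R r X y / n
  cov := (n : ℝ)⁻¹ • (Xᵀ * X)

/-- The training error `errR_KL`. -/
def trainErr (R : Matrix (Fin m) (Fin p) ℝ) (r : Fin m → ℝ)
    (X : Matrix (Fin n) (Fin p) ℝ) (y : Fin n → ℝ) : ℝ :=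
  negTwoLogLik X y (mle R r X y)

/-- The test error `ErrR_KL` of the model fitted to `(X, y)`: the expectation of `-2 log f` at a new
sample `(X', y')`, the fitted parameters being held fixed. The new sample lives on its own
probability space, so it is independent of the training sample. -/
def testErr {Ω : Type*} [MeasurableSpace Ω] (P' : Measure Ω)
    (X' : Ω → Matrix (Fin n) (Fin p) ℝ) (y' : Ω → Fin n → ℝ)
    (R : Matrix (Fin m) (Fin p) ℝ) (r : Fin m → ℝ)
    (X : Matrix (Fin n) (Fin p) ℝ) (y : Fin n → ℝ) : ℝ :=
  ∫ ω', negTwoLogLik (X' ω') (y' ω') (mle R r X y) ∂P'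

/-- The optimism `optR_KL = ErrR_KL - errR_KL`. -/
def optimism {Ω : Type*} [MeasurableSpace Ω] (P' : Measure Ω)
    (X' : Ω → Matrix (Fin n) (Fin p) ℝ) (y' : Ω → Fin n → ℝ)
    (R : Matrix (Fin m) (Fin p) ℝ) (r : Fin m → ℝ)
    (X : Matrix (Fin n) (Fin p) ℝ) (y : Fin n → ℝ) : ℝ :=
  testErr P' X' y' R r X y - trainErr R r X y

/-- The criterion `RAICc(R, r)`. -/
def raicc (R : Matrix (Fin m) (Fin p) ℝ) (r : Fin m → ℝ)
    (X : Matrix (Fin n) (Fin p) ℝ) (y : Fin n → ℝ) : ℝ :=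
  n * Real.log (rss R r X y / n) +
    n * ((n * (n - 1)) / (((n : ℝ) - p + m - 2) * ((n : ℝ) - p + m - 1)))

/-- The part of the unbiased estimator of the test error that does not involve the restrictions:
`n (p + 1) log (2π) + n · np / (n - p - 1) + n log |Σ̂|`, where `Σ̂ = XᵀX / n`. -/
def restrictionFree (X : Matrix (Fin n) (Fin p) ℝ) : ℝ :=
  n * (p + 1) * Real.log (2 * Real.pi) + n * ((n * p) / ((n : ℝ) - p - 1)) +
    n * Real.log ((n : ℝ)⁻¹ • (Xᵀ * X)).det

end RandomX

end

open RandomX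

/-! The feasible coefficients form the affine space `β₀ + ker R`. Choose `N` whose q = p - m columns
span `ker R` and are orthonormal for Σ₀. Then `X * N` has independent standard normal entries, β̂ -
β₀ = N b with b the least squares coefficient of ε on `X * N`, and RSS(R, r) is the residual sum of
squares of that regression (`betaHat_eq`, `rss_eq`). The restricted problem is thus an unrestricted
one with q white predictors.

For the MLE (`isRestrictedMLE_iff`), the excess of -2 log f over its claimed minimum is a sum of
three nonnegative gaps: Pythagoras for β, log t ≤ t - 1 for σ², and the same scalar inequality on
eigenvalues for Σ. Each vanishes only at the claimed value.

For the optimism, the logarithms of test and training error cancel. With errors scaled to unit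
variance and `N₀` a square matrix whitening Σ₀, what remains is n²/RSS + n²‖b‖²/RSS + n² tr(((X
N₀)ᵀ(X N₀))⁻¹) - n(p+1). Given `X * N`, a rotation (`exists_rotation`) makes b and RSS functions of
independent Gaussian coordinates, with RSS chi-squared on n - q degrees of freedom. So E[1/RSS] =
1/(n-q-2), and the conditional mean of ‖b‖²/RSS is the trace of the inverse Gram matrix times this
constant.

The mean of that trace needs no Wishart density. A diagonal entry of an inverse Gram matrix is the
reciprocal RSS of one column regressed on the others (`gram_insert_column`), so it is again an
inverse chi-squared mean, and the trace has mean q/(n-q-1). The first two terms then add up to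
n²(n-1)/((n-q-1)(n-q-2)). The same inverse moments dominate the logarithms, which gives
integrability. -/

open RandomX

/-! ### Determinant and trace inequalities, and the closed form of the log-likelihood. -/

open scoped MatrixOrder in
theorem Matrix.PosDef.exists_transpose_mul_self {ι : Type*} [Fintype ι] [DecidableEq ι]
    {S : Matrix ι ι ℝ} (hS : S.PosDef) : ∃ B : Matrix ι ι ℝ, IsUnit B ∧ S = Bᵀ * B := by
  obtain ⟨B, hB⟩ := CStarAlgebra.nonneg_iff_eq_star_mul_self.1 hS.posSemidef.nonneg
  rw [Matrix.star_eq_conjTranspose, Matrix.conjTranspose_eq_transpose_of_trivial] at hB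
  refine ⟨B, ?_, hB⟩
  have h := hS.det_pos
  rw [hB, Matrix.det_mul, Matrix.det_transpose] at h
  rw [Matrix.isUnit_iff_isUnit_det, isUnit_iff_ne_zero]
  rintro h0
  simp [h0] at h

theorem Matrix.PosDef.log_det_eq_sum {ι : Type*} [Fintype ι] [DecidableEq ι]
    {B : Matrix ι ι ℝ} (hB : B.PosDef) :
    Real.log B.det = ∑ i, Real.log (hB.1.eigenvalues i) := by
  rw [hB.1.det_eq_prod_eigenvalues]
  exact Real.log_prod (fun i _ => (hB.eigenvalues_pos i).ne')

theorem Matrix.PosDef.log_det_le {ι : Type*} [Fintype ι] [DecidableEq ι]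
    {B : Matrix ι ι ℝ} (hB : B.PosDef) : Real.log B.det ≤ B.trace - Fintype.card ι := by
  rw [hB.log_det_eq_sum, hB.1.trace_eq_sum_eigenvalues]
  calc _ ≤ ∑ i, (hB.1.eigenvalues i - 1) :=
        Finset.sum_le_sum fun i _ => Real.log_le_sub_one_of_pos (hB.eigenvalues_pos i)
    _ = _ := by simp

theorem Matrix.PosDef.eq_one_of_log_det_eq {ι : Type*} [Fintype ι] [DecidableEq ι]
    {B : Matrix ι ι ℝ} (hB : B.PosDef) (h : Real.log B.det = B.trace - Fintype.card ι) :
    B = 1 := by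
  have key : ∑ i, Real.log (hB.1.eigenvalues i) = ∑ i, (hB.1.eigenvalues i - 1) := by
    rw [← hB.log_det_eq_sum, h, hB.1.trace_eq_sum_eigenvalues]; simp
  have h1 := (Finset.sum_eq_sum_iff_of_le
    (fun i _ => Real.log_le_sub_one_of_pos (hB.eigenvalues_pos i))).1 key
  have h2 : hB.1.eigenvalues = 1 := by
    funext i
    by_contra hne
    exact (Real.log_lt_sub_one_of_pos (hB.eigenvalues_pos i) hne).ne (h1 i (Finset.mem_univ i))
  rw [hB.1.spectral_theorem, h2]
  have : (RCLike.ofReal ∘ (1 : ι → ℝ) : ι → ℝ) = 1 := by ext; simp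
  rw [this]
  simp

/-- Apply the upper bound on log det to both B and B⁻¹. This serves as the integrable majorant of
the log-determinant of the Gram matrix. -/
theorem Matrix.PosDef.abs_log_det_le {ι : Type*} [Fintype ι] [DecidableEq ι]
    {B : Matrix ι ι ℝ} (hB : B.PosDef) : |Real.log B.det| ≤ B.trace + B⁻¹.trace := by
  have h1 := hB.log_det_le
  have h2 := hB.inv.log_det_le
  have h3 : Real.log B⁻¹.det = - Real.log B.det := by
    rw [Matrix.det_nonsing_inv, Ring.inverse_eq_inv', Real.log_inv]
  have h4 : 0 ≤ B.trace := hB.posSemidef.trace_nonneg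
  have h5 : 0 ≤ B⁻¹.trace := hB.inv.posSemidef.trace_nonneg
  have h6 : (0 : ℝ) ≤ Fintype.card ι := by positivity
  rw [abs_le]
  constructor <;> linarith

/-- The Gaussian log-likelihood in the covariance is maximal exactly at the empirical covariance. -/
theorem Matrix.PosDef.log_det_add_trace {ι : Type*} [Fintype ι] [DecidableEq ι]
    {S A : Matrix ι ι ℝ} (hS : S.PosDef) (hA : A.PosDef) :
    Real.log A.det + Fintype.card ι ≤ Real.log S.det + (S⁻¹ * A).trace ∧
    (Real.log A.det + Fintype.card ι = Real.log S.det + (S⁻¹ * A).trace → S = A) := by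
  -- Whitening by a square root C of S⁻¹ turns the pair (S, A) into (1, C A Cᵀ), reducing the claim
  -- to `log_det_le` and its equality case.
  obtain ⟨C, hC, hSC⟩ := hS.inv.exists_transpose_mul_self
  have hB : (C * A * Cᵀ).PosDef := by
    have := hA.mul_mul_conjTranspose_same (B := C) (Matrix.vecMul_injective_of_isUnit hC)
    rwa [Matrix.conjTranspose_eq_transpose_of_trivial] at this
  have htr : (C * A * Cᵀ).trace = (S⁻¹ * A).trace := by
    rw [hSC, Matrix.trace_mul_comm, Matrix.mul_assoc]
  have hdet : Real.log (C * A * Cᵀ).det = Real.log A.det - Real.log S.det := by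
    have h : (C * A * Cᵀ).det = S⁻¹.det * A.det := by
      rw [hSC]; simp only [Matrix.det_mul, Matrix.det_transpose]; ring
    rw [h, Matrix.det_nonsing_inv, Ring.inverse_eq_inv',
      Real.log_mul (inv_ne_zero hS.det_pos.ne') hA.det_pos.ne', Real.log_inv]
    ring
  have h1 := hB.log_det_le
  rw [htr, hdet] at h1
  refine ⟨by linarith, fun h => ?_⟩
  have h2 := hB.eq_one_of_log_det_eq (by rw [htr, hdet]; linarith)
  have hSd := (Matrix.isUnit_iff_isUnit_det S).1 hS.isUnit
  have h3 : A * Cᵀ * C = 1 := by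
    exact _root_.mul_eq_one_comm.1 (by rw [← Matrix.mul_assoc, h2])
  rw [Matrix.mul_assoc, ← hSC] at h3
  calc S = (A * S⁻¹) * S := by rw [h3, one_mul]
    _ = A := by rw [Matrix.mul_assoc, Matrix.nonsing_inv_mul _ hSd, mul_one]

theorem Real.log_add_div_le {a s : ℝ} (ha : 0 < a) (hs : 0 < s) :
    Real.log a + 1 ≤ Real.log s + a / s ∧
    (Real.log a + 1 = Real.log s + a / s → s = a) := by
  have h0 : 0 < a / s := div_pos ha hs
  have h1 := Real.log_le_sub_one_of_pos h0
  have h2 := Real.log_div ha.ne' hs.ne'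
  refine ⟨by linarith, fun h => ?_⟩
  by_contra hne
  have h3 : a / s ≠ 1 := fun h => hne ((div_eq_one_iff_eq hs.ne').1 h).symm
  have := Real.log_lt_sub_one_of_pos h0 h3
  linarith

theorem Matrix.dotProduct_mulVec_sum_rows {n p : ℕ} (X : Matrix (Fin n) (Fin p) ℝ)
    (M : Matrix (Fin p) (Fin p) ℝ) :
    ∑ i, X i ⬝ᵥ (M *ᵥ X i) = (M * (Xᵀ * X)).trace := by
  simp only [Matrix.trace, Matrix.diag, Matrix.mul_apply, dotProduct, Matrix.mulVec,
    Matrix.transpose_apply, Finset.mul_sum]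
  rw [Finset.sum_comm]
  refine Finset.sum_congr rfl fun j _ => ?_
  rw [Finset.sum_comm]
  refine Finset.sum_congr rfl fun k _ => Finset.sum_congr rfl fun i _ => by ring

namespace RandomX

theorem negTwoLogLik_eq {n p : ℕ} (X : Matrix (Fin n) (Fin p) ℝ) (y : Fin n → ℝ) (θ : Params p)
    (hv : 0 < θ.var) (hS : θ.cov.PosDef) :
    negTwoLogLik X y θ = n * Real.log (2 * Real.pi * θ.var)
      + (∑ i, (y i - (X *ᵥ θ.β) i) ^ 2) / θ.var + n * p * Real.log (2 * Real.pi)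
      + n * Real.log θ.cov.det + (θ.cov⁻¹ * (Xᵀ * X)).trace := by
  have hpi := Real.pi_pos
  have hd := hS.det_pos
  have hone : ∀ i, -2 * Real.log (obsDensity θ (y i) (X i)) =
      Real.log (2 * Real.pi * θ.var) + (y i - (X *ᵥ θ.β) i) ^ 2 / θ.var
        + p * Real.log (2 * Real.pi) + Real.log θ.cov.det + X i ⬝ᵥ (θ.cov⁻¹ *ᵥ X i) := by
    intro i
    have e1 : (X *ᵥ θ.β) i = X i ⬝ᵥ θ.β := rfl
    have h1 : 0 < √(2 * Real.pi * θ.var) := by positivity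
    have h2 : 0 < √((2 * Real.pi) ^ p * θ.cov.det) := by positivity
    rw [obsDensity, gaussianPDFReal, rowDensity, Real.coe_toNNReal _ hv.le, e1,
      Real.log_mul (by positivity) (by positivity), Real.log_mul (by positivity) (by positivity),
      Real.log_mul (by positivity) (by positivity), Real.log_exp, Real.log_exp, Real.log_inv,
      Real.log_inv, Real.log_sqrt (by positivity), Real.log_sqrt (by positivity),
      Real.log_mul (x := (2 * Real.pi) ^ p) (by positivity) (by positivity), Real.log_pow]
    field_simp
    ring
  have hpos : ∀ i, obsDensity θ (y i) (X i) ≠ 0 := by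
    intro i
    have hv' : θ.var.toNNReal ≠ 0 := by simpa using hv
    exact (mul_pos (gaussianPDFReal_pos _ _ _ hv') (by unfold rowDensity; positivity)).ne'
  rw [negTwoLogLik, Real.log_prod (fun i _ => hpos i), Finset.mul_sum,
    Finset.sum_congr rfl (fun i _ => hone i)]
  simp only [Finset.sum_add_distrib, Finset.sum_const, Finset.card_univ, Fintype.card_fin,
    nsmul_eq_mul, ← Finset.sum_div, Matrix.dotProduct_mulVec_sum_rows]
  ring

end RandomX

/-! ### Restricted least squares and the joint maximum likelihood estimate. -/

theorem Matrix.posDef_transpose_mul_self_iff {n p : ℕ} {X : Matrix (Fin n) (Fin p) ℝ} :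
    (Xᵀ * X).PosDef ↔ Function.Injective X.mulVec := by
  constructor
  · intro h
    have h1 := Matrix.mulVec_injective_of_isUnit h.isUnit
    intro v w hvw
    apply h1
    rw [← Matrix.mulVec_mulVec, ← Matrix.mulVec_mulVec, hvw]
  · intro h
    have := Matrix.PosDef.conjTranspose_mul_self X h
    rwa [Matrix.conjTranspose_eq_transpose_of_trivial] at this

theorem Matrix.posDef_transpose_mul_self_of_det_ne_zero {n p : ℕ} {X : Matrix (Fin n) (Fin p) ℝ}
    (h : (Xᵀ * X).det ≠ 0) : (Xᵀ * X).PosDef := by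
  have h1 := Matrix.mulVec_injective_of_isUnit
    ((Matrix.isUnit_iff_isUnit_det _).2 (isUnit_iff_ne_zero.2 h))
  rw [Matrix.posDef_transpose_mul_self_iff]
  intro v w hvw
  apply h1
  rw [← Matrix.mulVec_mulVec, ← Matrix.mulVec_mulVec, hvw]

/-- Take any basis K of the kernel and normalise it: if KᵀSK = BᵀB, then K B⁻¹ is orthonormal for S.
-/
theorem Matrix.exists_orthonormal_ker {p m : ℕ} {S : Matrix (Fin p) (Fin p) ℝ} (hS : S.PosDef)
    (R : Matrix (Fin m) (Fin p) ℝ) (hR : R.rank = m) :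
    ∃ N : Matrix (Fin p) (Fin (p - m)) ℝ, R * N = 0 ∧ Nᵀ * S * N = 1 ∧
      ∀ v, R *ᵥ v = 0 → ∃ c, v = N *ᵥ c := by
  have hfr : Module.finrank ℝ (LinearMap.ker R.mulVecLin) = p - m := by
    have h := LinearMap.finrank_range_add_finrank_ker R.mulVecLin
    rw [show Module.finrank ℝ (LinearMap.range R.mulVecLin) = R.rank from rfl, hR] at h
    simp at h
    omega
  let b := Module.finBasisOfFinrankEq ℝ _ hfr
  let K : Matrix (Fin p) (Fin (p - m)) ℝ := Matrix.of fun i j => (b j : Fin p → ℝ) i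
  have hK : ∀ c, K *ᵥ c = ((∑ j, c j • b j : LinearMap.ker R.mulVecLin) : Fin p → ℝ) := by
    intro c
    ext i
    simp [K, Matrix.mulVec, dotProduct, Finset.sum_apply, mul_comm]
  have hRK : ∀ c, R *ᵥ (K *ᵥ c) = 0 := by
    intro c
    rw [hK]
    exact (∑ j, c j • b j : LinearMap.ker R.mulVecLin).2
  have hKinj : Function.Injective K.mulVec := by
    intro c d hcd
    simp only [hK] at hcd
    have h1 := Subtype.ext hcd
    rw [← b.equivFun_symm_apply, ← b.equivFun_symm_apply] at h1
    exact b.equivFun.symm.injective h1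
  have hT : (Kᵀ * S * K).PosDef := by
    have := hS.conjTranspose_mul_mul_same hKinj
    rwa [Matrix.conjTranspose_eq_transpose_of_trivial] at this
  obtain ⟨B, hB, hTB⟩ := hT.exists_transpose_mul_self
  have hBd := (Matrix.isUnit_iff_isUnit_det B).1 hB
  refine ⟨K * B⁻¹, ?_, ?_, ?_⟩
  · have : R * K = 0 := by
      ext i j
      have := congrFun (hRK (Pi.single j 1)) i
      rw [Matrix.mulVec_mulVec, Matrix.mulVec_single_one] at this
      exact this
    rw [← Matrix.mul_assoc, this, Matrix.zero_mul]
  · have h1 : (K * B⁻¹)ᵀ * S * (K * B⁻¹) = (B⁻¹)ᵀ * (Kᵀ * S * K) * B⁻¹ := by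
      rw [Matrix.transpose_mul]; simp only [Matrix.mul_assoc]
    have h2 : (B⁻¹)ᵀ * Bᵀ = 1 := by
      rw [← Matrix.transpose_mul, Matrix.mul_nonsing_inv _ hBd, Matrix.transpose_one]
    rw [h1, hTB, ← Matrix.mul_assoc, h2, one_mul, Matrix.mul_nonsing_inv _ hBd]
  · intro v hv
    let w : LinearMap.ker R.mulVecLin := ⟨v, hv⟩
    refine ⟨B *ᵥ (b.equivFun w), ?_⟩
    rw [Matrix.mulVec_mulVec, Matrix.mul_assoc, Matrix.nonsing_inv_mul _ hBd, Matrix.mul_one, hK,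
      ← b.equivFun_symm_apply, LinearEquiv.symm_apply_apply]

namespace RandomX

/-- The residual sum of squares of the least squares regression of `e` on the columns of `U`. -/
noncomputable def olsRss {n q : ℕ} (U : Matrix (Fin n) (Fin q) ℝ) (e : Fin n → ℝ) : ℝ :=
  ∑ i, (e i - (U *ᵥ betaFull U e) i) ^ 2

theorem gram_mulVec_betaFull {n q : ℕ} {U : Matrix (Fin n) (Fin q) ℝ} (hU : (Uᵀ * U).PosDef)
    (e : Fin n → ℝ) : (Uᵀ * U) *ᵥ betaFull U e = Uᵀ *ᵥ e := by
  rw [betaFull, Matrix.mulVec_mulVec, Matrix.mul_nonsing_inv _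
    ((Matrix.isUnit_iff_isUnit_det _).1 hU.isUnit), Matrix.one_mulVec]

theorem transpose_mulVec_residual {n q : ℕ} {U : Matrix (Fin n) (Fin q) ℝ}
    (hU : (Uᵀ * U).PosDef) (e : Fin n → ℝ) : Uᵀ *ᵥ (e - U *ᵥ betaFull U e) = 0 := by
  rw [Matrix.mulVec_sub, Matrix.mulVec_mulVec, gram_mulVec_betaFull hU, sub_self]

theorem eq_betaFull {n q : ℕ} {U : Matrix (Fin n) (Fin q) ℝ} (hU : (Uᵀ * U).PosDef)
    (e : Fin n → ℝ) (c : Fin q → ℝ) (h : Uᵀ *ᵥ (e - U *ᵥ c) = 0) : c = betaFull U e := by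
  rw [Matrix.mulVec_sub, Matrix.mulVec_mulVec, sub_eq_zero] at h
  rw [betaFull, h, Matrix.mulVec_mulVec, Matrix.nonsing_inv_mul _
    ((Matrix.isUnit_iff_isUnit_det _).1 hU.isUnit), Matrix.one_mulVec]

theorem sum_sq_eq_dotProduct {n : ℕ} (v : Fin n → ℝ) : ∑ i, v i ^ 2 = v ⬝ᵥ v := by
  simp [dotProduct, sq]

/-- Pythagoras for the least squares fit. -/
theorem sum_sq_residual {n q : ℕ} {U : Matrix (Fin n) (Fin q) ℝ} (hU : (Uᵀ * U).PosDef)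
    (e : Fin n → ℝ) (c : Fin q → ℝ) :
    ∑ i, (e i - (U *ᵥ c) i) ^ 2 = olsRss U e +
      (c - betaFull U e) ⬝ᵥ ((Uᵀ * U) *ᵥ (c - betaFull U e)) := by
  set d := c - betaFull U e with hd
  set z := e - U *ᵥ betaFull U e with hz
  have h0 : Uᵀ *ᵥ z = 0 := transpose_mulVec_residual hU e
  have h1 : e - U *ᵥ c = z - U *ᵥ d := by
    rw [hz, hd, Matrix.mulVec_sub]; abel
  have h2 : z ⬝ᵥ (U *ᵥ d) = 0 := by
    rw [Matrix.dotProduct_mulVec, ← Matrix.mulVec_transpose, h0, zero_dotProduct]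
  have h3 : (U *ᵥ d) ⬝ᵥ (U *ᵥ d) = d ⬝ᵥ ((Uᵀ * U) *ᵥ d) := by
    rw [← Matrix.mulVec_mulVec, Matrix.dotProduct_mulVec d, ← Matrix.mulVec_transpose,
      Matrix.transpose_transpose]
  have h4 : ∑ i, (e i - (U *ᵥ c) i) ^ 2 = (e - U *ᵥ c) ⬝ᵥ (e - U *ᵥ c) :=
    sum_sq_eq_dotProduct (e - U *ᵥ c)
  have h5 : olsRss U e = z ⬝ᵥ z := sum_sq_eq_dotProduct z
  rw [h4, h5, h1]
  clear_value z d
  rw [sub_dotProduct, dotProduct_sub, dotProduct_sub, h2, dotProduct_comm (U *ᵥ d) z, h2, h3]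
  ring

theorem posDef_gram_mul {n p q : ℕ} {X : Matrix (Fin n) (Fin p) ℝ} {N : Matrix (Fin p) (Fin q) ℝ}
    {S : Matrix (Fin p) (Fin p) ℝ} (hX : (Xᵀ * X).PosDef) (hN : Nᵀ * S * N = 1) :
    ((X * N)ᵀ * (X * N)).PosDef := by
  rw [Matrix.posDef_transpose_mul_self_iff] at hX ⊢
  intro c d hcd
  simp only [← Matrix.mulVec_mulVec] at hcd
  have h1 := hX hcd
  have h2 : (Nᵀ * S * N) *ᵥ c = (Nᵀ * S * N) *ᵥ d := by
    rw [← Matrix.mulVec_mulVec, h1, Matrix.mulVec_mulVec]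
  simpa [hN] using h2

/-- The restricted estimator is the least squares estimator in coordinates of the restricted
space. -/
theorem betaHat_eq {n p m q : ℕ} {X : Matrix (Fin n) (Fin p) ℝ} {N : Matrix (Fin p) (Fin q) ℝ}
    {R : Matrix (Fin m) (Fin p) ℝ} {S : Matrix (Fin p) (Fin p) ℝ} (hX : (Xᵀ * X).PosDef)
    (hR : R.rank = m) (hRN : R * N = 0) (hN : Nᵀ * S * N = 1)
    (hker : ∀ v, R *ᵥ v = 0 → ∃ c, v = N *ᵥ c) (β₀ : Fin p → ℝ) (e : Fin n → ℝ) :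
    betaHat R (R *ᵥ β₀) X (X *ᵥ β₀ + e) = β₀ + N *ᵥ betaFull (X * N) e := by
  set y := X *ᵥ β₀ + e with hy
  set A := Xᵀ * X with hA
  have hAd := (Matrix.isUnit_iff_isUnit_det _).1 hX.isUnit
  -- Full row rank of R makes the inverse in the definition of `betaHat` a genuine one.
  have hT : (R * A⁻¹ * Rᵀ).PosDef := by
    have hinj : Function.Injective R.vecMul := by
      rw [Matrix.vecMul_injective_iff]
      rw [linearIndependent_iff_card_eq_finrank_span, Fintype.card_fin, Set.finrank,
        ← Matrix.rank_eq_finrank_span_row, hR]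
    have := hX.inv.mul_mul_conjTranspose_same hinj
    rwa [Matrix.conjTranspose_eq_transpose_of_trivial] at this
  have hTd := (Matrix.isUnit_iff_isUnit_det _).1 hT.isUnit
  -- μ is the Lagrange multiplier of the constraint. The residual satisfies Xᵀ(y - Xβ̂) = -Rᵀμ,
  -- which Nᵀ annihilates because R N = 0; these are the normal equations for `X * N`.
  set μ := (R * A⁻¹ * Rᵀ)⁻¹ *ᵥ (R *ᵥ β₀ - R *ᵥ betaFull X y) with hμ
  have hb : betaHat R (R *ᵥ β₀) X y = betaFull X y + A⁻¹ *ᵥ (Rᵀ *ᵥ μ) := by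
    rw [betaHat, hμ]
    simp only [Matrix.mulVec_mulVec, Matrix.mul_assoc, hA]
  have hRb : R *ᵥ betaHat R (R *ᵥ β₀) X y = R *ᵥ β₀ := by
    rw [hb, Matrix.mulVec_add, Matrix.mulVec_mulVec, Matrix.mulVec_mulVec, hμ,
      Matrix.mulVec_mulVec, Matrix.mul_nonsing_inv _ hTd, Matrix.one_mulVec]
    abel
  obtain ⟨c, hc⟩ := hker (betaHat R (R *ᵥ β₀) X y - β₀) (by
    rw [Matrix.mulVec_sub, hRb, sub_self])
  have hb' : betaHat R (R *ᵥ β₀) X y = β₀ + N *ᵥ c := by rw [← hc]; abel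
  have hnorm : Xᵀ *ᵥ (y - X *ᵥ betaHat R (R *ᵥ β₀) X y) = -(Rᵀ *ᵥ μ) := by
    rw [hb, Matrix.mulVec_add, ← sub_sub, Matrix.mulVec_sub, transpose_mulVec_residual hX,
      Matrix.mulVec_mulVec, Matrix.mulVec_mulVec, ← hA, Matrix.mul_nonsing_inv _ hAd,
      Matrix.one_mulVec, zero_sub]
  have hres : y - X *ᵥ betaHat R (R *ᵥ β₀) X y = e - (X * N) *ᵥ c := by
    rw [hb', hy, Matrix.mulVec_add, Matrix.mulVec_mulVec]; abel
  rw [hb', ← eq_betaFull (posDef_gram_mul hX hN) e c]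
  rw [Matrix.transpose_mul, ← Matrix.mulVec_mulVec, ← hres, hnorm, Matrix.mulVec_neg,
    Matrix.mulVec_mulVec, ← Matrix.transpose_mul, hRN]
  simp

theorem rss_eq {n p m q : ℕ} {X : Matrix (Fin n) (Fin p) ℝ} {N : Matrix (Fin p) (Fin q) ℝ}
    {R : Matrix (Fin m) (Fin p) ℝ} {S : Matrix (Fin p) (Fin p) ℝ} (hX : (Xᵀ * X).PosDef)
    (hR : R.rank = m) (hRN : R * N = 0) (hN : Nᵀ * S * N = 1)
    (hker : ∀ v, R *ᵥ v = 0 → ∃ c, v = N *ᵥ c) (β₀ : Fin p → ℝ) (e : Fin n → ℝ) :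
    rss R (R *ᵥ β₀) X (X *ᵥ β₀ + e) = olsRss (X * N) e := by
  rw [rss, betaHat_eq hX hR hRN hN hker, olsRss]
  refine Finset.sum_congr rfl fun i _ => ?_
  rw [Matrix.mulVec_add, Matrix.mulVec_mulVec, Pi.add_apply, Pi.add_apply]
  ring

/-- The joint maximum likelihood estimate exists, is unique and has the closed form `mle`. -/
theorem isRestrictedMLE_iff {n p m q : ℕ} {X : Matrix (Fin n) (Fin p) ℝ}
    {N : Matrix (Fin p) (Fin q) ℝ}
    {R : Matrix (Fin m) (Fin p) ℝ} {S : Matrix (Fin p) (Fin p) ℝ} (hn : 0 < n)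
    (hX : (Xᵀ * X).PosDef)
    (hR : R.rank = m) (hRN : R * N = 0) (hN : Nᵀ * S * N = 1)
    (hker : ∀ v, R *ᵥ v = 0 → ∃ c, v = N *ᵥ c) (β₀ : Fin p → ℝ) (e : Fin n → ℝ)
    (hrss : 0 < olsRss (X * N) e) (θ : Params p) :
    IsRestrictedMLE R (R *ᵥ β₀) X (X *ᵥ β₀ + e) θ ↔ θ = mle R (R *ᵥ β₀) X (X *ᵥ β₀ + e) := by
  set y := X *ᵥ β₀ + e with hy
  set r := R *ᵥ β₀ with hr
  set U := X * N with hUdef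
  have hU : (Uᵀ * U).PosDef := posDef_gram_mul hX hN
  have hn' : (0 : ℝ) < n := by exact_mod_cast hn
  have hbeta : betaHat R r X y = β₀ + N *ᵥ betaFull U e := betaHat_eq hX hR hRN hN hker β₀ e
  have hrss' : rss R r X y = olsRss U e := rss_eq hX hR hRN hN hker β₀ e
  have hv : 0 < (mle R r X y).var := by
    change 0 < rss R r X y / n
    rw [hrss']; positivity
  have hcov : (mle R r X y).cov.PosDef := by
    change ((n : ℝ)⁻¹ • (Xᵀ * X)).PosDef
    exact hX.smul (by positivity)
  have hmem : mle R r X y ∈ restrictedParams R r := by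
    refine ⟨?_, hv, hcov⟩
    change R *ᵥ betaHat R r X y = r
    rw [hbeta, Matrix.mulVec_add, Matrix.mulVec_mulVec, hRN, Matrix.zero_mulVec, add_zero]
  have hresid : ∀ c, y - X *ᵥ (β₀ + N *ᵥ c) = e - U *ᵥ c := by
    intro c; rw [hy, Matrix.mulVec_add, Matrix.mulVec_mulVec]; abel
  have key : ∀ θ ∈ restrictedParams R r, negTwoLogLik X y (mle R r X y) ≤ negTwoLogLik X y θ ∧
      (negTwoLogLik X y θ = negTwoLogLik X y (mle R r X y) → θ = mle R r X y) := by
    rintro θ ⟨hθ1, hθ2, hθ3⟩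
    obtain ⟨c, hc⟩ := hker (θ.β - β₀) (by rw [Matrix.mulVec_sub, hθ1, sub_self])
    have hc' : θ.β = β₀ + N *ᵥ c := by rw [← hc]; abel
    have hss : ∑ i, (y i - (X *ᵥ θ.β) i) ^ 2 = olsRss U e +
        (c - betaFull U e) ⬝ᵥ ((Uᵀ * U) *ᵥ (c - betaFull U e)) := by
      rw [← sum_sq_residual hU, hc']
      exact Finset.sum_congr rfl fun i _ => congrArg (· ^ 2) (congrFun (hresid c) i)
    have hquad : 0 ≤ (c - betaFull U e) ⬝ᵥ ((Uᵀ * U) *ᵥ (c - betaFull U e)) := by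
      simpa using hU.posSemidef.dotProduct_mulVec_nonneg (c - betaFull U e)
    rw [negTwoLogLik_eq X y θ hθ2 hθ3, negTwoLogLik_eq X y _ hv hcov, hss]
    have hmss : ∑ i, (y i - (X *ᵥ (mle R r X y).β) i) ^ 2 = olsRss U e := hrss'
    have hmv : (mle R r X y).var = olsRss U e / n := by rw [← hrss']; rfl
    have hmc : (mle R r X y).cov = (n : ℝ)⁻¹ • (Xᵀ * X) := rfl
    rw [hmss]
    -- Since XᵀX = n Σ̂, the trace term has the form required by `log_det_add_trace` with A = Σ̂.
    have e1 : ∀ T : Matrix (Fin p) (Fin p) ℝ,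
        (T⁻¹ * (Xᵀ * X)).trace = n * (T⁻¹ * (mle R r X y).cov).trace := by
      intro T
      rw [hmc, Matrix.mul_smul, Matrix.trace_smul, smul_eq_mul, mul_inv_cancel_left₀ hn'.ne']
    have e2 : ((mle R r X y).cov⁻¹ * (mle R r X y).cov).trace = p := by
      rw [Matrix.nonsing_inv_mul _ ((Matrix.isUnit_iff_isUnit_det _).1 hcov.isUnit)]
      simp
    rw [e1 θ.cov, e1 (mle R r X y).cov, e2]
    obtain ⟨hd1, hd2⟩ := hθ3.log_det_add_trace hcov
    rw [Fintype.card_fin] at hd1 hd2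
    obtain ⟨hs1, hs2⟩ := Real.log_add_div_le hv hθ2
    have e3 : olsRss U e = n * (mle R r X y).var := by rw [hmv]; field_simp
    have hl : ∀ s : ℝ, 0 < s → Real.log (2 * Real.pi * s) = Real.log (2 * Real.pi) + Real.log s :=
      fun s hs => Real.log_mul (by positivity) hs.ne'
    rw [hl _ hθ2, hl _ hv, e3, add_div, mul_div_assoc, mul_div_assoc, div_self hv.ne']
    set Q := (c - betaFull U e) ⬝ᵥ ((Uᵀ * U) *ᵥ (c - betaFull U e)) with hQ
    have hQ' : 0 ≤ Q / θ.var := by positivity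
    have hd1' := mul_le_mul_of_nonneg_left hd1 hn'.le
    have hs1' := mul_le_mul_of_nonneg_left hs1 hn'.le
    -- The difference of the two likelihoods is Q/σ² plus n times the gaps in `hs1` and `hd1`.
    -- Equality forces all three nonnegative terms to vanish.
    refine ⟨by nlinarith, fun h => ?_⟩
    have q0 : Q / θ.var = 0 := by nlinarith
    have q1 : Real.log (mle R r X y).var + 1 = Real.log θ.var + (mle R r X y).var / θ.var := by
      apply le_antisymm hs1
      apply le_of_mul_le_mul_left _ hn'
      nlinarith
    have q2 : Real.log (mle R r X y).cov.det + p =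
        Real.log θ.cov.det + (θ.cov⁻¹ * (mle R r X y).cov).trace := by
      apply le_antisymm hd1
      apply le_of_mul_le_mul_left _ hn'
      nlinarith
    have q3 : c = betaFull U e := by
      by_contra hne
      have := hU.dotProduct_mulVec_pos (sub_ne_zero.2 hne)
      rw [star_trivial, ← hQ] at this
      exact (div_pos this hθ2).ne' q0
    ext1
    · rw [hc', q3]; exact hbeta.symm
    · exact hs2 q1
    · exact hd2 q2
  constructor
  · rintro ⟨h1, h2⟩
    exact (key θ h1).2 (le_antisymm (h2 hmem) (key θ h1).1)
  · rintro rfl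
    exact ⟨hmem, fun θ hθ => (key θ hθ).1⟩

end RandomX

/-! ### Laplace transforms and moments of standard Gaussian vectors. -/

open Set Filter Topology in
theorem lintegral_Ioi_one_add_rpow {k : ℝ} (hk : 2 < k) :
    ∫⁻ s in Set.Ioi (0 : ℝ), ENNReal.ofReal ((1 + 2 * s) ^ (-(k / 2))) =
      ENNReal.ofReal (1 / (k - 2)) := by
  -- An antiderivative that vanishes at infinity because k > 2; its value at 0 is -1/(k-2).
  set g : ℝ → ℝ := fun s => -((1 + 2 * s) ^ (1 - k / 2)) / (k - 2) with hg
  have hk' : k - 2 ≠ 0 := by linarith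
  have hderiv : ∀ s ∈ Ici (0 : ℝ), HasDerivAt g ((1 + 2 * s) ^ (-(k / 2))) s := by
    intro s hs
    have hs' : (0 : ℝ) ≤ s := hs
    have h1 : HasDerivAt (fun s : ℝ => 1 + 2 * s) 2 s := by
      simpa using ((hasDerivAt_id s).const_mul 2).const_add 1
    have h2 := ((h1.rpow_const (p := 1 - k / 2) (Or.inl (by positivity))).neg).div_const (k - 2)
    refine h2.congr_deriv ?_
    rw [show 1 - k / 2 - 1 = -(k / 2) by ring]
    field_simp
    ring
  have hpos : ∀ s ∈ Ioi (0 : ℝ), 0 ≤ (1 + 2 * s) ^ (-(k / 2)) := by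
    intro s hs
    have hs' : (0 : ℝ) < s := hs
    positivity
  have hlim : Tendsto g atTop (𝓝 0) := by
    have h1 : Tendsto (fun s : ℝ => 1 + 2 * s) atTop atTop :=
      tendsto_atTop_add_const_left _ _ (tendsto_id.const_mul_atTop two_pos)
    have h2 := (tendsto_rpow_neg_atTop (y := k / 2 - 1) (by linarith)).comp h1
    have h3 := (h2.neg).div_const (k - 2)
    simp only [neg_zero, zero_div] at h3
    refine h3.congr fun s => ?_
    simp [hg, Function.comp]
  have hint := integrableOn_Ioi_deriv_of_nonneg' hderiv hpos hlim
  have hval := integral_Ioi_of_hasDerivAt_of_nonneg' hderiv hpos hlim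
  rw [← ofReal_integral_eq_lintegral_ofReal hint
    ((ae_restrict_iff' measurableSet_Ioi).2 (ae_of_all _ hpos)), hval]
  congr 1
  simp only [hg]
  simp
  field_simp

theorem integral_exp_neg_mul_sq_gaussianReal {s : ℝ} (hs : 0 < s) :
    ∫ z, Real.exp (-s * z ^ 2) ∂(gaussianReal 0 1) = (1 + 2 * s) ^ (-(1 / 2 : ℝ)) := by
  rw [integral_gaussianReal_eq_integral_smul one_ne_zero]
  have h1 : ∀ z : ℝ, gaussianPDFReal 0 1 z • Real.exp (-s * z ^ 2) =
      (√(2 * Real.pi))⁻¹ * Real.exp (-(s + 1 / 2) * z ^ 2) := by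
    intro z
    simp only [gaussianPDFReal, smul_eq_mul, NNReal.coe_one, mul_one, sub_zero]
    rw [mul_assoc, ← Real.exp_add]
    congr 2
    ring
  simp_rw [h1]
  rw [integral_const_mul, integral_gaussian, ← Real.sqrt_inv, ← Real.sqrt_mul (by positivity),
    Real.rpow_neg (by positivity), ← Real.sqrt_eq_rpow, ← Real.sqrt_inv]
  congr 1
  have := Real.pi_pos
  field_simp
  ring

-- This turns inverse moments into integrals of Laplace transforms. At a = 0 both sides are ∞, so no
-- positivity is needed beforehand.
open Set in
theorem ENNReal.inv_ofReal_eq_lintegral {a : ℝ} (ha : 0 ≤ a) :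
    (ENNReal.ofReal a)⁻¹ = ∫⁻ s in Set.Ioi (0 : ℝ), ENNReal.ofReal (Real.exp (-s * a)) := by
  rcases ha.eq_or_lt with rfl | ha
  · simp
  · have h1 : IntegrableOn (fun s => Real.exp (-a * s)) (Ioi 0) := exp_neg_integrableOn_Ioi 0 ha
    have h2 : ∫ s in Ioi (0 : ℝ), Real.exp (-a * s) = a⁻¹ := by
      rw [integral_exp_mul_Ioi (by linarith)]
      simp
    have h3 : ∀ s, Real.exp (-s * a) = Real.exp (-a * s) := fun s => by congr 1; ring
    simp_rw [h3]
    rw [← ofReal_integral_eq_lintegral_ofReal h1 (ae_of_all _ fun s => (Real.exp_pos _).le), h2,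
      ENNReal.ofReal_inv_of_pos ha]

namespace RandomX

/-- The standard Gaussian measure on `ℝᵏ`. -/
noncomputable abbrev stdVec (ι : Type*) [Fintype ι] : Measure (ι → ℝ) :=
  Measure.pi fun _ => gaussianReal 0 1

/-- The law of an `n × q` matrix with independent standard Gaussian entries. -/
noncomputable abbrev stdMat (n q : ℕ) : Measure (Fin n → Fin q → ℝ) :=
  Measure.pi fun _ => stdVec (Fin q)

theorem lintegral_exp_neg_sum_sq {k : ℕ} {s : ℝ} (hs : 0 < s) :
    ∫⁻ c, ENNReal.ofReal (Real.exp (-s * ∑ i, c i ^ 2)) ∂(stdVec (Fin k)) =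
      ENNReal.ofReal ((1 + 2 * s) ^ (-((k : ℝ) / 2))) := by
  have hmeas : Measurable fun c : Fin k → ℝ => Real.exp (-s * ∑ i, c i ^ 2) := by fun_prop
  have hint : Integrable (fun c : Fin k → ℝ => Real.exp (-s * ∑ i, c i ^ 2)) (stdVec (Fin k)) := by
    refine Integrable.of_bound hmeas.aestronglyMeasurable 1 (ae_of_all _ fun c => ?_)
    rw [Real.norm_eq_abs, abs_of_pos (Real.exp_pos _), Real.exp_le_one_iff]
    have : 0 ≤ ∑ i, c i ^ 2 := by positivity
    nlinarith
  rw [← ofReal_integral_eq_lintegral_ofReal hint (ae_of_all _ fun s => (Real.exp_pos _).le)]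
  congr 1
  simp_rw [Finset.mul_sum, Real.exp_sum]
  rw [integral_fintype_prod_eq_prod (fun _ (z : ℝ) => Real.exp (-s * z ^ 2))]
  simp_rw [integral_exp_neg_mul_sq_gaussianReal hs]
  rw [Finset.prod_const, Finset.card_univ, Fintype.card_fin, ← Real.rpow_natCast,
    ← Real.rpow_mul (by positivity)]
  congr 1
  ring

/-- The mean of the inverse chi-squared distribution. -/
theorem lintegral_inv_sum_sq {k : ℕ} (hk : 2 < k) :
    ∫⁻ c, (ENNReal.ofReal (∑ i, c i ^ 2))⁻¹ ∂(stdVec (Fin k)) =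
      ENNReal.ofReal (1 / ((k : ℝ) - 2)) := by
  have h1 : ∀ c : Fin k → ℝ, (ENNReal.ofReal (∑ i, c i ^ 2))⁻¹ =
      ∫⁻ s in Set.Ioi (0 : ℝ), ENNReal.ofReal (Real.exp (-s * ∑ i, c i ^ 2)) :=
    fun c => ENNReal.inv_ofReal_eq_lintegral (by positivity)
  simp_rw [h1]
  -- By Tonelli, integrate the Laplace transform (1+2s)^(-k/2) of the chi-squared law over s > 0.
  rw [lintegral_lintegral_swap (by fun_prop),
    setLIntegral_congr_fun measurableSet_Ioi (fun s hs => lintegral_exp_neg_sum_sq hs),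
    lintegral_Ioi_one_add_rpow (by exact_mod_cast hk)]

theorem integral_mul_stdVec {k : ℕ} (i j : Fin k) :
    Integrable (fun c : Fin k → ℝ => c i * c j) (stdVec (Fin k)) ∧
    ∫ c, c i * c j ∂(stdVec (Fin k)) = if i = j then 1 else 0 := by
  have hm : ∀ i, MemLp (fun c : Fin k → ℝ => c i) 2 (stdVec (Fin k)) := fun i =>
    (memLp_id_gaussianReal 2).comp_measurePreserving (measurePreserving_eval _ i)
  have hmean : ∀ i, ∫ c, c i ∂(stdVec (Fin k)) = 0 := fun i => by
    rw [integral_comp_eval (X := fun _ => ℝ) (μ := fun _ => gaussianReal 0 1)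
      (f := fun z : ℝ => z) (i := i) (by fun_prop)]
    exact integral_id_gaussianReal
  refine ⟨(hm i).integrable_mul (hm j), ?_⟩
  split_ifs with h
  · subst h
    rw [integral_comp_eval (X := fun _ => ℝ) (μ := fun _ => gaussianReal 0 1)
      (f := fun z : ℝ => z * z) (i := i) (by fun_prop)]
    have h2 := variance_id_gaussianReal (μ := 0) (v := 1)
    rw [variance_eq_sub (memLp_id_gaussianReal 2)] at h2
    simp only [Pi.pow_apply, id, integral_id_gaussianReal] at h2
    simpa [sq] using h2
  · have hind : IndepFun (fun c : Fin k → ℝ => c i) (fun c : Fin k → ℝ => c j)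
        (stdVec (Fin k)) :=
      (iIndepFun_pi (X := fun _ : Fin k => (id : ℝ → ℝ)) (fun _ => aemeasurable_id)).indepFun h
    have := hind.integral_fun_mul_eq_mul_integral (hm i).1 (hm j).1
    rw [this, hmean, zero_mul]

theorem lintegral_sum_sq_mulVec {k l : ℕ} (M : Matrix (Fin l) (Fin k) ℝ) :
    ∫⁻ c, ENNReal.ofReal (∑ i, (M *ᵥ c) i ^ 2) ∂(stdVec (Fin k)) =
      ENNReal.ofReal (M * Mᵀ).trace := by
  have h1 : ∀ c : Fin k → ℝ, ∑ i, (M *ᵥ c) i ^ 2 =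
      ∑ i, ∑ a, ∑ b, M i a * M i b * (c a * c b) := by
    intro c
    refine Finset.sum_congr rfl fun i _ => ?_
    rw [sq, Matrix.mulVec, dotProduct, Finset.sum_mul_sum]
    exact Finset.sum_congr rfl fun a _ => Finset.sum_congr rfl fun b _ => by ring
  have hi : ∀ i a b, Integrable (fun c : Fin k → ℝ => M i a * M i b * (c a * c b))
      (stdVec (Fin k)) := fun i a b => (integral_mul_stdVec a b).1.const_mul _
  rw [← ofReal_integral_eq_lintegral_ofReal]
  · congr 1
    simp_rw [h1]
    rw [integral_finsetSum _ fun i _ => integrable_finsetSum _ fun a _ =>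
      integrable_finsetSum _ fun b _ => hi i a b, Matrix.trace]
    refine Finset.sum_congr rfl fun i _ => ?_
    rw [integral_finsetSum _ fun a _ => integrable_finsetSum _ fun b _ => hi i a b,
      Matrix.diag, Matrix.mul_apply]
    refine Finset.sum_congr rfl fun a _ => ?_
    rw [integral_finsetSum _ fun b _ => hi i a b]
    simp [integral_const_mul, (integral_mul_stdVec a _).2, Matrix.transpose_apply]
  · simp_rw [h1]
    exact integrable_finsetSum _ fun i _ => integrable_finsetSum _ fun a _ =>
      integrable_finsetSum _ fun b _ => hi i a b
  · exact ae_of_all _ fun c => by positivity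

open WithLp in
/-- A linear image of a Gaussian vector with identity covariance is standard Gaussian. -/
theorem measurePreserving_mulVec_multivariateGaussian {ι κ : Type*} [Fintype ι] [DecidableEq ι]
    [Fintype κ] [DecidableEq κ] {S : Matrix ι ι ℝ} (hS : S.PosSemidef) {N : Matrix ι κ ℝ}
    (hN : Nᵀ * S * N = 1) :
    MeasurePreserving (fun x : EuclideanSpace ℝ ι => Nᵀ *ᵥ x.ofLp) (multivariateGaussian 0 S)
      (stdVec κ) := by
  have hmeas : Measurable (fun x : EuclideanSpace ℝ ι => Nᵀ *ᵥ x.ofLp) := by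
    refine measurable_pi_lambda _ fun k => ?_
    simp only [Matrix.mulVec, dotProduct]
    fun_prop
  refine ⟨hmeas, ?_⟩
  apply (MeasurableEquiv.toLp 2 (κ → ℝ)).map_measurableEquiv_injective
  have hlp : Measurable (toLp 2 : (κ → ℝ) → EuclideanSpace ℝ κ) := by fun_prop
  rw [MeasurableEquiv.coe_toLp, map_pi_eq_stdGaussian, Measure.map_map hlp hmeas]
  -- The characteristic function at t is that of the original Gaussian at N t, and (N t)ᵀ S (N t) =
  -- ‖t‖² by `hN`.
  apply Measure.ext_of_charFun
  ext t
  rw [charFun_stdGaussian, charFun_apply, integral_map (hlp.comp hmeas).aemeasurable (by fun_prop)]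
  have h1 : ∀ x : EuclideanSpace ℝ ι,
      inner ℝ (((toLp 2) ∘ fun x : EuclideanSpace ℝ ι => Nᵀ *ᵥ x.ofLp) x) t =
        inner ℝ x (toLp 2 (N *ᵥ t.ofLp)) := by
    intro x
    simp only [Function.comp, EuclideanSpace.inner_eq_star_dotProduct, star_trivial]
    rw [Matrix.dotProduct_mulVec, Matrix.vecMul_transpose]
  simp_rw [h1]
  rw [← charFun_apply, charFun_multivariateGaussian hS]
  have h2 : (N *ᵥ t.ofLp) ⬝ᵥ (S *ᵥ (N *ᵥ t.ofLp)) = ‖t‖ ^ 2 := by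
    rw [Matrix.mulVec_mulVec, ← Matrix.vecMul_transpose, ← Matrix.dotProduct_mulVec,
      Matrix.mulVec_mulVec, ← Matrix.mul_assoc, hN, Matrix.one_mulVec,
      EuclideanSpace.real_norm_sq_eq]
    simp [dotProduct, sq]
  simp only [inner_zero_right, h2]
  congr 1
  push_cast
  ring

end RandomX

/-! ### Measurability of the least squares statistics. -/

theorem Matrix.measurable_inv_apply {Ω : Type*} [MeasurableSpace Ω] {q : ℕ}
    {M : Ω → Matrix (Fin q) (Fin q) ℝ} (hM : ∀ i j, Measurable fun ω => M ω i j) (i j : Fin q) :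
    Measurable fun ω => (M ω)⁻¹ i j := by
  have hf : Measurable fun ω => (fun a b => M ω a b : Fin q → Fin q → ℝ) :=
    measurable_pi_lambda _ fun a => measurable_pi_lambda _ fun b => hM a b
  have hdet : Continuous fun N : Fin q → Fin q → ℝ => (Matrix.of N).det :=
    Continuous.matrix_det continuous_id
  have hadj : Continuous fun N : Fin q → Fin q → ℝ => (Matrix.of N).adjugate i j :=
    (Continuous.matrix_adjugate continuous_id).matrix_elem i j
  have h : ∀ ω, (M ω)⁻¹ i j = ((Matrix.of fun a b => M ω a b).det)⁻¹ *
      (Matrix.of fun a b => M ω a b).adjugate i j := by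
    intro ω
    rw [Matrix.inv_def, Ring.inverse_eq_inv', Matrix.smul_apply, smul_eq_mul]
    rfl
  simp_rw [h]
  exact (hdet.measurable.comp hf).inv.mul (hadj.measurable.comp hf)

namespace RandomX

theorem measurable_gram_inv {Ω : Type*} [MeasurableSpace Ω] {n q : ℕ}
    {U : Ω → Matrix (Fin n) (Fin q) ℝ} (hU : ∀ i j, Measurable fun ω => U ω i j) (i j : Fin q) :
    Measurable fun ω => ((U ω)ᵀ * U ω)⁻¹ i j := by
  refine Matrix.measurable_inv_apply (fun a b => ?_) i j
  simp only [Matrix.mul_apply, Matrix.transpose_apply]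
  fun_prop

theorem measurable_betaFull {Ω : Type*} [MeasurableSpace Ω] {n q : ℕ}
    {U : Ω → Matrix (Fin n) (Fin q) ℝ} {e : Ω → Fin n → ℝ}
    (hU : ∀ i j, Measurable fun ω => U ω i j) (he : ∀ i, Measurable fun ω => e ω i) (j : Fin q) :
    Measurable fun ω => betaFull (U ω) (e ω) j := by
  have hG := measurable_gram_inv hU
  have h : ∀ ω, betaFull (U ω) (e ω) j =
      ∑ k, ((U ω)ᵀ * U ω)⁻¹ j k * ∑ i, U ω i k * e ω i := fun ω => rfl
  simp_rw [h]
  exact Finset.measurable_fun_sum _ fun k _ => (hG j k).mul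
    (Finset.measurable_fun_sum _ fun i _ => (hU i k).mul (he i))

theorem measurable_olsRss {Ω : Type*} [MeasurableSpace Ω] {n q : ℕ}
    {U : Ω → Matrix (Fin n) (Fin q) ℝ} {e : Ω → Fin n → ℝ}
    (hU : ∀ i j, Measurable fun ω => U ω i j) (he : ∀ i, Measurable fun ω => e ω i) :
    Measurable fun ω => olsRss (U ω) (e ω) := by
  have hb := measurable_betaFull hU he
  have h : ∀ ω, olsRss (U ω) (e ω) =
      ∑ i, (e ω i - ∑ k, U ω i k * betaFull (U ω) (e ω) k) ^ 2 := fun ω => rfl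
  simp_rw [h]
  exact Finset.measurable_fun_sum _ fun i _ => ((he i).sub
    (Finset.measurable_fun_sum _ fun k _ => (hU i k).mul (hb k))).pow_const 2

theorem olsRss_nonneg {n q : ℕ} (U : Matrix (Fin n) (Fin q) ℝ) (e : Fin n → ℝ) :
    0 ≤ olsRss U e := by
  unfold olsRss; positivity

/-! ### Independence of the fitted coefficients and the residual. -/

/-- The hypothesis says that the block matrix (W | M) has orthonormal rows, so it sends a standard
Gaussian vector on the disjoint union of the indices to a standard one. -/
theorem measurePreserving_add_mulVec {n q k : ℕ} {W : Matrix (Fin n) (Fin q) ℝ}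
    {M : Matrix (Fin n) (Fin k) ℝ} (h : W * Wᵀ + M * Mᵀ = 1) :
    MeasurePreserving (fun z : (Fin q → ℝ) × (Fin k → ℝ) => W *ᵥ z.1 + M *ᵥ z.2)
      ((stdVec (Fin q)).prod (stdVec (Fin k))) (stdVec (Fin n)) := by
  have h1 := (measurePreserving_sumPiEquivProdPi_symm
    (fun _ : Fin q ⊕ Fin k => gaussianReal 0 1))
  have h2 : MeasurePreserving (WithLp.toLp 2) (stdVec (Fin q ⊕ Fin k))
      (multivariateGaussian 0 (1 : Matrix (Fin q ⊕ Fin k) (Fin q ⊕ Fin k) ℝ)) :=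
    ⟨by fun_prop, by rw [map_pi_eq_stdGaussian, multivariateGaussian_zero_one]⟩
  have h3 := measurePreserving_mulVec_multivariateGaussian (S := 1) .one
    (N := Matrix.fromRows Wᵀ Mᵀ) (by
      rw [Matrix.mul_one, Matrix.transpose_fromRows, Matrix.fromCols_mul_fromRows,
        Matrix.transpose_transpose, Matrix.transpose_transpose, h])
  have h4 := h3.comp (h2.comp h1)
  convert h4 using 1
  ext z i
  simp only [Function.comp, Matrix.transpose_fromRows, Matrix.transpose_transpose,
    Matrix.fromCols_mulVec]
  rfl

/-- In suitable orthonormal coordinates, the least squares estimator depends only on the first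
`q` coordinates of the response and the residual sum of squares only on the remaining ones. -/
theorem exists_rotation {n q : ℕ} {U : Matrix (Fin n) (Fin q) ℝ} (hU : (Uᵀ * U).PosDef) :
    ∃ (L : Matrix (Fin q) (Fin q) ℝ) (W : Matrix (Fin n) (Fin q) ℝ)
      (M : Matrix (Fin n) (Fin (n - q)) ℝ),
      (Uᵀ * U)⁻¹ = L * Lᵀ ∧ W * Wᵀ + M * Mᵀ = 1 ∧
      ∀ a c, betaFull U (W *ᵥ a + M *ᵥ c) = L *ᵥ a ∧
        olsRss U (W *ᵥ a + M *ᵥ c) = ∑ i, c i ^ 2 := by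
  obtain ⟨B, hB, hUB⟩ := hU.exists_transpose_mul_self
  have hBd := (Matrix.isUnit_iff_isUnit_det B).1 hB
  have hBB : B * B⁻¹ = 1 := Matrix.mul_nonsing_inv _ hBd
  have hBB' : B⁻¹ * B = 1 := Matrix.nonsing_inv_mul _ hBd
  have hBt : (B⁻¹)ᵀ * Bᵀ = 1 := by rw [← Matrix.transpose_mul, hBB, Matrix.transpose_one]
  -- U = W B with orthonormal columns in W, as in a QR factorisation. The columns of M below
  -- complete W to an orthonormal basis, as an orthonormal basis of the kernel of Wᵀ.
  set W := U * B⁻¹ with hW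
  have hUW : U = W * B := by rw [hW, Matrix.mul_assoc, hBB', Matrix.mul_one]
  have hWW : Wᵀ * W = 1 := by
    have : Wᵀ * W = (B⁻¹)ᵀ * (Uᵀ * U) * B⁻¹ := by
      rw [hW, Matrix.transpose_mul]; simp only [Matrix.mul_assoc]
    rw [this, hUB, ← Matrix.mul_assoc, hBt, one_mul, hBB]
  have hrank : (Wᵀ).rank = q := by
    apply le_antisymm (by simpa using Matrix.rank_le_height Wᵀ)
    have := Matrix.rank_mul_le_left Wᵀ W
    rwa [hWW, Matrix.rank_one, Fintype.card_fin] at this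
  obtain ⟨M, hWM, hMM, hker⟩ := Matrix.exists_orthonormal_ker
    (Matrix.PosDef.one (n := Fin n) (R := ℝ)) Wᵀ hrank
  rw [Matrix.mul_one] at hMM
  have hMW : Mᵀ * W = 0 := by
    rw [← Matrix.transpose_transpose W, ← Matrix.transpose_mul, hWM, Matrix.transpose_zero]
  have hinv : (Uᵀ * U)⁻¹ = B⁻¹ * (B⁻¹)ᵀ := by
    rw [hUB, Matrix.mul_inv_rev, Matrix.transpose_nonsing_inv]
  have hUB' : U * B⁻¹ = W := rfl
  clear_value W
  refine ⟨B⁻¹, W, M, hinv, ?_, fun a c => ?_⟩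
  -- Completeness of the basis: v - W Wᵀ v lies in the kernel of Wᵀ, hence equals M c, and applying
  -- Mᵀ identifies c as Mᵀ v.
  · apply Matrix.ext_of_mulVec_single
    intro i
    set v : Fin n → ℝ := Pi.single i 1
    obtain ⟨c, hc⟩ := hker (v - W *ᵥ (Wᵀ *ᵥ v)) (by
      rw [Matrix.mulVec_sub, Matrix.mulVec_mulVec, hWW, Matrix.one_mulVec, sub_self])
    have hv : v = W *ᵥ (Wᵀ *ᵥ v) + M *ᵥ c := by rw [← hc]; abel
    have hc' : Mᵀ *ᵥ v = c := by
      rw [hv, Matrix.mulVec_add, Matrix.mulVec_mulVec _ Mᵀ W, hMW, Matrix.mulVec_mulVec _ Mᵀ M, hMM]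
      simp
    rw [Matrix.add_mulVec, ← Matrix.mulVec_mulVec _ W, ← Matrix.mulVec_mulVec _ M, hc', ← hv,
      Matrix.one_mulVec]
  · have hbeta : B⁻¹ *ᵥ a = betaFull U (W *ᵥ a + M *ᵥ c) := by
      apply eq_betaFull hU
      have : U *ᵥ (B⁻¹ *ᵥ a) = W *ᵥ a := by rw [Matrix.mulVec_mulVec, hUB']
      rw [this, add_sub_cancel_left, Matrix.mulVec_mulVec, hUW, Matrix.transpose_mul,
        Matrix.mul_assoc, hWM]
      simp
    refine ⟨hbeta.symm, ?_⟩
    have h1 : (W *ᵥ a + M *ᵥ c) - U *ᵥ betaFull U (W *ᵥ a + M *ᵥ c) = M *ᵥ c := by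
      rw [← hbeta, Matrix.mulVec_mulVec, hUB', add_sub_cancel_left]
    have h2 : olsRss U (W *ᵥ a + M *ᵥ c) = (M *ᵥ c) ⬝ᵥ (M *ᵥ c) := by
      rw [← sum_sq_eq_dotProduct]
      exact Finset.sum_congr rfl fun i _ => congrArg (· ^ 2) (congrFun h1 i)
    rw [h2, sum_sq_eq_dotProduct, Matrix.dotProduct_mulVec, Matrix.vecMul_mulVec, hMM,
      Matrix.vecMul_one]

/-- In the rotated coordinates e = W a + M c, the integrands depend on a only through ‖L a‖² and on
c only through ‖c‖⁻², so they factor. The first factor has mean tr(L Lᵀ) = tr((UᵀU)⁻¹), and the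
second is an inverse chi-squared on n - q > 2 degrees of freedom. -/
theorem lintegral_betaFull_olsRss {n q : ℕ} {U : Matrix (Fin n) (Fin q) ℝ}
    (hU : (Uᵀ * U).PosDef) (hq : q + 2 < n) :
    ∫⁻ e, (ENNReal.ofReal (olsRss U e))⁻¹ ∂(stdVec (Fin n)) =
      ENNReal.ofReal (1 / ((n : ℝ) - q - 2)) ∧
    ∫⁻ e, ENNReal.ofReal (∑ j, betaFull U e j ^ 2) * (ENNReal.ofReal (olsRss U e))⁻¹
        ∂(stdVec (Fin n)) =
      ENNReal.ofReal ((Uᵀ * U)⁻¹).trace * ENNReal.ofReal (1 / ((n : ℝ) - q - 2)) := by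
  obtain ⟨L, W, M, hL, hWM, hac⟩ := exists_rotation hU
  have hmp := measurePreserving_add_mulVec hWM
  have hm1 : Measurable fun e => olsRss U e :=
    measurable_olsRss (U := fun _ => U) (e := fun e => e) (fun _ _ => measurable_const)
      (fun i => measurable_pi_apply i)
  have hm2 : ∀ j, Measurable fun e => betaFull U e j := fun j =>
    measurable_betaFull (U := fun _ => U) (e := fun e => e) (fun _ _ => measurable_const)
      (fun i => measurable_pi_apply i) j
  have hchi := lintegral_inv_sum_sq (k := n - q) (by omega)
  rw [Nat.cast_sub (by omega)] at hchi
  have hmc : AEMeasurable (fun c : Fin (n - q) → ℝ => (ENNReal.ofReal (∑ i, c i ^ 2))⁻¹)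
      (stdVec (Fin (n - q))) := (by fun_prop : Measurable _).aemeasurable
  constructor
  · rw [← hmp.lintegral_comp (by fun_prop)]
    simp_rw [(hac _ _).2]
    have := lintegral_prod_mul (μ := stdVec (Fin q)) (f := fun _ => 1) aemeasurable_const hmc
    simpa [hchi] using this
  · rw [← hmp.lintegral_comp (by fun_prop)]
    simp_rw [(hac _ _).1, (hac _ _).2]
    have hma : AEMeasurable (fun a : Fin q → ℝ => ENNReal.ofReal (∑ j, (L *ᵥ a) j ^ 2))
        (stdVec (Fin q)) := by
      simp only [Matrix.mulVec, dotProduct]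
      exact (by fun_prop : Measurable _).aemeasurable
    rw [lintegral_prod_mul hma hmc, hchi, lintegral_sum_sq_mulVec, hL]

theorem ae_olsRss_pos {n q : ℕ} {U : Matrix (Fin n) (Fin q) ℝ}
    (hU : (Uᵀ * U).PosDef) (hq : q + 2 < n) : ∀ᵐ e ∂(stdVec (Fin n)), 0 < olsRss U e := by
  have hm1 : Measurable fun e => olsRss U e :=
    measurable_olsRss (U := fun _ => U) (e := fun e => e) (fun _ _ => measurable_const)
      (fun i => measurable_pi_apply i)
  -- A finite mean makes the extended reciprocal finite almost surely, and (0 : ℝ≥0∞)⁻¹ = ∞ then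
  -- excludes a zero residual.
  have h := ae_lt_top (μ := stdVec (Fin n)) (f := fun e => (ENNReal.ofReal (olsRss U e))⁻¹)
    (by fun_prop) (by rw [(lintegral_betaFull_olsRss hU hq).1]; simp)
  filter_upwards [h] with e he
  simpa using he

/-! ### Gram matrices of standard Gaussian designs: invertibility and mean inverse trace. -/

/-- The diagonal of the inverse of a Gram matrix: the reciprocal of the residual sum of squares of
a column regressed on the others. -/
theorem gram_insert_column {n q : ℕ} (j : Fin (q + 1)) (U : Matrix (Fin n) (Fin (q + 1)) ℝ)
    (V : Matrix (Fin n) (Fin q) ℝ) (u : Fin n → ℝ) (hu : ∀ i, U i j = u i)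
    (hV : ∀ i k, U i (j.succAbove k) = V i k) (hVp : (Vᵀ * V).PosDef) (hr : 0 < olsRss V u) :
    (Uᵀ * U).PosDef ∧ (Uᵀ * U)⁻¹ j j = (olsRss V u)⁻¹ := by
  have hmul : ∀ v : Fin (q + 1) → ℝ, U *ᵥ v = v j • u + V *ᵥ (fun k => v (j.succAbove k)) := by
    intro v
    ext i
    simp only [Matrix.mulVec, dotProduct, Pi.add_apply, Pi.smul_apply, smul_eq_mul]
    rw [Fin.sum_univ_succAbove _ j, hu]
    simp only [hV]
    ring
  have hVi := Matrix.posDef_transpose_mul_self_iff.1 hVp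
  have hPD : (Uᵀ * U).PosDef := by
    rw [Matrix.posDef_transpose_mul_self_iff]
    refine (injective_iff_map_eq_zero U.mulVecLin).2 fun v hv => ?_
    rw [Matrix.mulVecLin_apply, hmul] at hv
    -- Otherwise u would lie in the column space of V and its residual sum of squares would be zero.
    have hvj : v j = 0 := by
      by_contra hne
      have h1 : u = V *ᵥ (-(v j)⁻¹ • fun k => v (j.succAbove k)) := by
        have h2 : u = (v j)⁻¹ • (v j • u) := by rw [smul_smul, inv_mul_cancel₀ hne, one_smul]
        rw [h2, eq_neg_of_add_eq_zero_left hv, Matrix.mulVec_smul, neg_smul, smul_neg]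
      have h3 := sum_sq_residual hVp u (-(v j)⁻¹ • fun k => v (j.succAbove k))
      have h0 : ∑ i, (u i - (V *ᵥ (-(v j)⁻¹ • fun k => v (j.succAbove k))) i) ^ 2 = 0 := by
        rw [← h1]; simp
      have h4 := hVp.posSemidef.dotProduct_mulVec_nonneg
        ((-(v j)⁻¹ • fun k => v (j.succAbove k)) - betaFull V u)
      rw [star_trivial] at h4
      linarith
    rw [hvj, zero_smul, zero_add] at hv
    have h5 : (fun k => v (j.succAbove k)) = 0 := hVi (by simpa using hv)
    ext k
    refine Fin.succAboveCases j ?_ (fun k => ?_) k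
    · exact hvj
    · exact congrFun h5 k
  refine ⟨hPD, ?_⟩
  set b := betaFull V u with hb
  set z := u - V *ᵥ b with hz
  -- With coefficient 1 on column j and -b on the rest, U v is the residual z of u on V. It is
  -- orthogonal to the other columns, so UᵀU v = RSS · e_j; coordinate j of v = (UᵀU)⁻¹(RSS · e_j)
  -- gives the entry.
  set v : Fin (q + 1) → ℝ := j.insertNth 1 (-b) with hv
  have hUv : U *ᵥ v = z := by
    rw [hmul]
    have : (fun k => v (j.succAbove k)) = -b := by ext k; simp [hv]
    rw [this, Matrix.mulVec_neg, hz]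
    simp [hv, sub_eq_add_neg]
  have hVz : Vᵀ *ᵥ z = 0 := transpose_mulVec_residual hVp u
  have huz : u ⬝ᵥ z = olsRss V u := by
    have h1 : olsRss V u = z ⬝ᵥ z := sum_sq_eq_dotProduct z
    have h2 : (V *ᵥ b) ⬝ᵥ z = 0 := by
      rw [dotProduct_comm, Matrix.dotProduct_mulVec, ← Matrix.mulVec_transpose, hVz,
        zero_dotProduct]
    have h3 : u = z + V *ᵥ b := by rw [hz]; abel
    rw [h1]
    conv_lhs => rw [h3]
    rw [add_dotProduct, h2, add_zero]
  have hUz : Uᵀ *ᵥ z = Pi.single j (olsRss V u) := by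
    ext k
    refine Fin.succAboveCases j ?_ (fun k => ?_) k
    · rw [Pi.single_eq_same, ← huz]
      simp only [Matrix.mulVec, dotProduct, Matrix.transpose_apply, hu]
    · rw [Pi.single_eq_of_ne (Fin.succAbove_ne j k)]
      have := congrFun hVz k
      simpa only [Matrix.mulVec, dotProduct, Matrix.transpose_apply, hV, Pi.zero_apply] using this
  have hd := (Matrix.isUnit_iff_isUnit_det _).1 hPD.isUnit
  have h6 : v = (Uᵀ * U)⁻¹ *ᵥ Pi.single j (olsRss V u) := by
    rw [← hUz, ← hUv, Matrix.mulVec_mulVec _ Uᵀ U, Matrix.mulVec_mulVec,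
      Matrix.nonsing_inv_mul _ hd, Matrix.one_mulVec]
  have h7 := congrFun h6 j
  rw [Matrix.mulVec_single] at h7
  simp only [hv, Fin.insertNth_apply_same, Pi.smul_apply, MulOpposite.smul_eq_mul_unop,
    MulOpposite.unop_op, Matrix.col_apply] at h7
  exact eq_inv_of_mul_eq_one_left h7.symm

theorem measurable_gram_det {Ω : Type*} [MeasurableSpace Ω] {n q : ℕ}
    {U : Ω → Matrix (Fin n) (Fin q) ℝ} (hU : ∀ i j, Measurable fun ω => U ω i j) :
    Measurable fun ω => ((U ω)ᵀ * U ω).det := by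
  have hf : Measurable fun ω => (fun a b => U ω a b : Fin n → Fin q → ℝ) :=
    measurable_pi_lambda _ fun a => measurable_pi_lambda _ fun b => hU a b
  have hid : Continuous fun N : Fin n → Fin q → ℝ => (Matrix.of N) := continuous_id
  have hdet : Continuous fun N : Fin n → Fin q → ℝ => ((Matrix.of N)ᵀ * Matrix.of N).det :=
    (hid.matrix_transpose.matrix_mul hid).matrix_det
  exact hdet.measurable.comp hf

theorem measurePreserving_splitColumn (n : ℕ) {q : ℕ} (j : Fin (q + 1)) :
    MeasurePreserving (fun U : Fin n → Fin (q + 1) → ℝ =>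
      ((fun i k => U i (j.succAbove k), fun i => U i j) : (Fin n → Fin q → ℝ) × (Fin n → ℝ)))
      (stdMat n (q + 1)) ((stdMat n q).prod (stdVec (Fin n))) := by
  have h1 := measurePreserving_pi (fun _ : Fin n => stdVec (Fin (q + 1)))
    (fun _ => (gaussianReal 0 1).prod (stdVec (Fin q)))
    (fun _ => measurePreserving_piFinSuccAbove (fun _ : Fin (q + 1) => gaussianReal 0 1) j)
  have h2 := measurePreserving_arrowProdEquivProdArrow ℝ (Fin q → ℝ) (Fin n)
    (fun _ => gaussianReal 0 1) (fun _ => stdVec (Fin q))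
  exact Measure.measurePreserving_swap.comp (h2.comp h1)

theorem measurable_olsRss_prod (n q : ℕ) :
    Measurable fun z : (Fin n → Fin q → ℝ) × (Fin n → ℝ) => olsRss (Matrix.of z.1) z.2 :=
  measurable_olsRss (fun i j => by simp only [Matrix.of_apply]; fun_prop) (fun i => by fun_prop)

theorem ae_prod_posDef_olsRss_pos {n q : ℕ} (hq : q + 2 < n)
    (h : ∀ᵐ V ∂(stdMat n q), ((Matrix.of V)ᵀ * Matrix.of V).PosDef) :
    ∀ᵐ z ∂((stdMat n q).prod (stdVec (Fin n))),
      ((Matrix.of z.1)ᵀ * Matrix.of z.1).PosDef ∧ 0 < olsRss (Matrix.of z.1) z.2 := by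
  -- The event is rephrased by det ≠ 0, which is visibly measurable and equivalent to positive
  -- definiteness for a Gram matrix.
  have hm1 : Measurable fun z : (Fin n → Fin q → ℝ) × (Fin n → ℝ) =>
      ((Matrix.of z.1)ᵀ * Matrix.of z.1).det :=
    measurable_gram_det fun i j => by simp only [Matrix.of_apply]; fun_prop
  have hm2 := measurable_olsRss_prod n q
  have hms : MeasurableSet {z : (Fin n → Fin q → ℝ) × (Fin n → ℝ) |
      ((Matrix.of z.1)ᵀ * Matrix.of z.1).det ≠ 0 ∧ 0 < olsRss (Matrix.of z.1) z.2} :=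
    (hm1 (measurableSet_singleton 0).compl).inter (measurableSet_lt measurable_const hm2)
  have key : ∀ᵐ z ∂((stdMat n q).prod (stdVec (Fin n))),
      ((Matrix.of z.1)ᵀ * Matrix.of z.1).det ≠ 0 ∧ 0 < olsRss (Matrix.of z.1) z.2 := by
    refine (Measure.ae_prod_iff_ae_ae hms).2 ?_
    filter_upwards [h] with V hV
    filter_upwards [ae_olsRss_pos hV hq] with e he
    exact ⟨hV.det_pos.ne', he⟩
  filter_upwards [key] with z hz
  exact ⟨Matrix.posDef_transpose_mul_self_of_det_ne_zero hz.1, hz.2⟩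

/-- Induction on the number of columns: a new independent Gaussian column almost surely has a
nonzero residual on the previous ones. -/
theorem ae_posDef_gram_stdMat {n : ℕ} : ∀ {q : ℕ}, q + 1 < n →
    ∀ᵐ U ∂(stdMat n q), ((Matrix.of U)ᵀ * Matrix.of U).PosDef
  | 0, _ => ae_of_all _ fun U =>
      Matrix.posDef_transpose_mul_self_iff.2 (Function.injective_of_subsingleton _)
  | q + 1, hq => by
    have ih := ae_prod_posDef_olsRss_pos hq (ae_posDef_gram_stdMat (q := q) (by omega))
    have := (measurePreserving_splitColumn n (0 : Fin (q + 1))).quasiMeasurePreserving.ae ih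
    filter_upwards [this] with U hU
    exact (gram_insert_column 0 (Matrix.of U) _ _ (fun i => rfl) (fun i k => rfl) hU.1 hU.2).1

theorem lintegral_inv_olsRss_prod {n q : ℕ} (hq : q + 2 < n) :
    ∫⁻ z, (ENNReal.ofReal (olsRss (Matrix.of z.1) z.2))⁻¹ ∂((stdMat n q).prod (stdVec (Fin n))) =
      ENNReal.ofReal (1 / ((n : ℝ) - q - 2)) := by
  have hm2 := measurable_olsRss_prod n q
  rw [lintegral_prod _ (by exact hm2.ennreal_ofReal.inv.aemeasurable),
    lintegral_congr_ae (g := fun _ => ENNReal.ofReal (1 / ((n : ℝ) - q - 2)))]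
  · simp
  · filter_upwards [ae_posDef_gram_stdMat (n := n) (q := q) (by omega)] with V hV
    exact (lintegral_betaFull_olsRss hV hq).1

/-- Column j is a standard Gaussian vector independent of the q others, so its RSS on them has n - q
degrees of freedom. -/
theorem lintegral_gram_inv_diag {n q : ℕ} (hq : q + 2 < n) (j : Fin (q + 1)) :
    ∫⁻ U, ENNReal.ofReal (((Matrix.of U)ᵀ * Matrix.of U)⁻¹ j j) ∂(stdMat n (q + 1)) =
      ENNReal.ofReal (1 / ((n : ℝ) - q - 2)) := by
  have hV := ae_posDef_gram_stdMat (n := n) (q := q) (by omega)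
  have hmp := measurePreserving_splitColumn n j
  have hm2 := measurable_olsRss_prod n q
  have hcongr : ∀ᵐ U ∂(stdMat n (q + 1)),
      ENNReal.ofReal (((Matrix.of U)ᵀ * Matrix.of U)⁻¹ j j) =
        (ENNReal.ofReal (olsRss (Matrix.of fun i k => U i (j.succAbove k))
          (fun i => U i j)))⁻¹ := by
    filter_upwards [hmp.quasiMeasurePreserving.ae (ae_prod_posDef_olsRss_pos hq hV)] with U hU
    rw [(gram_insert_column j (Matrix.of U) (Matrix.of fun i k => U i (j.succAbove k))
      (fun i => U i j) (fun i => rfl) (fun i k => rfl) hU.1 hU.2).2,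
      ENNReal.ofReal_inv_of_pos hU.2]
  rw [lintegral_congr_ae hcongr]
  have h1 := hmp.lintegral_comp (f := fun z => (ENNReal.ofReal (olsRss (Matrix.of z.1) z.2))⁻¹)
    (by fun_prop)
  rw [h1]
  exact lintegral_inv_olsRss_prod hq

/-- The mean of the trace of an inverse Wishart matrix. -/
theorem lintegral_trace_gram_inv {n q : ℕ} (hq : q + 1 < n) :
    ∫⁻ U, ENNReal.ofReal (((Matrix.of U)ᵀ * Matrix.of U)⁻¹).trace ∂(stdMat n q) =
      ENNReal.ofReal (q / ((n : ℝ) - q - 1)) := by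
  rcases q with _ | q
  · simp [Matrix.trace]
  have hm : ∀ j, Measurable fun U : Fin n → Fin (q + 1) → ℝ =>
      ((Matrix.of U)ᵀ * Matrix.of U)⁻¹ j j := fun j =>
    measurable_gram_inv (fun i j => by simp only [Matrix.of_apply]; fun_prop) j j
  have hcongr : ∀ᵐ U ∂(stdMat n (q + 1)),
      ENNReal.ofReal (((Matrix.of U)ᵀ * Matrix.of U)⁻¹).trace =
        ∑ j, ENNReal.ofReal (((Matrix.of U)ᵀ * Matrix.of U)⁻¹ j j) := by
    filter_upwards [ae_posDef_gram_stdMat hq] with U hU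
    rw [Matrix.trace, ENNReal.ofReal_sum_of_nonneg]
    · rfl
    · exact fun j _ => hU.inv.diag_pos.le
  rw [lintegral_congr_ae hcongr, lintegral_finsetSum _ fun j _ => (hm j).ennreal_ofReal]
  simp_rw [lintegral_gram_inv_diag hq]
  have hn : (q : ℝ) + 2 < n := by exact_mod_cast hq
  rw [Finset.sum_const, Finset.card_univ, Fintype.card_fin, nsmul_eq_mul,
    ← ENNReal.ofReal_natCast, ← ENNReal.ofReal_mul (by positivity)]
  congr 1
  push_cast
  rw [show (n : ℝ) - (q + 1) - 1 = n - q - 2 by ring]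
  ring

/-- Integrating first over the response leaves the trace of the inverse Gram matrix times a
constant, whose mean is known. -/
theorem lintegral_betaFull_sq_div_olsRss_prod {n q : ℕ} (hq : q + 2 < n) :
    ∫⁻ z, ENNReal.ofReal (∑ j, betaFull (Matrix.of z.1) z.2 j ^ 2) *
        (ENNReal.ofReal (olsRss (Matrix.of z.1) z.2))⁻¹ ∂((stdMat n q).prod (stdVec (Fin n))) =
      ENNReal.ofReal (q / ((n : ℝ) - q - 1) * (1 / ((n : ℝ) - q - 2))) := by
  have hm2 := measurable_olsRss_prod n q
  have hm3 : ∀ j, Measurable fun z : (Fin n → Fin q → ℝ) × (Fin n → ℝ) =>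
      betaFull (Matrix.of z.1) z.2 j := fun j =>
    measurable_betaFull (fun i j => by simp only [Matrix.of_apply]; fun_prop)
      (fun i => by fun_prop) j
  have hm4 : Measurable fun U : Fin n → Fin q → ℝ =>
      (((Matrix.of U)ᵀ * Matrix.of U)⁻¹).trace :=
    Finset.measurable_fun_sum _ fun j _ =>
      measurable_gram_inv (fun i j => by simp only [Matrix.of_apply]; fun_prop) j j
  rw [lintegral_prod _ (by fun_prop),
    lintegral_congr_ae (g := fun U : Fin n → Fin q → ℝ =>
      ENNReal.ofReal (((Matrix.of U)ᵀ * Matrix.of U)⁻¹).trace *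
        ENNReal.ofReal (1 / ((n : ℝ) - q - 2)))]
  · rw [lintegral_mul_const _ hm4.ennreal_ofReal, lintegral_trace_gram_inv (by omega),
      ← ENNReal.ofReal_mul]
    have hn : (q : ℝ) + 2 < n := by exact_mod_cast hq
    exact div_nonneg (by positivity) (by linarith)
  · filter_upwards [ae_posDef_gram_stdMat (n := n) (q := q) (by omega)] with V hV
    exact (lintegral_betaFull_olsRss hV hq).2

end RandomX

/-! ### Real-valued moments and integrability of the logarithms. -/

theorem integrable_and_integral_eq_of_lintegral_ofReal {Ω : Type*} [MeasurableSpace Ω]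
    {μ : Measure Ω} {f : Ω → ℝ} {c : ℝ} (hf : AEStronglyMeasurable f μ) (hpos : 0 ≤ᵐ[μ] f)
    (hc : 0 ≤ c) (h : ∫⁻ ω, ENNReal.ofReal (f ω) ∂μ = ENNReal.ofReal c) :
    Integrable f μ ∧ ∫ ω, f ω ∂μ = c := by
  refine ⟨⟨hf, ?_⟩, ?_⟩
  · rw [hasFiniteIntegral_iff_ofReal hpos, h]
    exact ENNReal.ofReal_lt_top
  · rw [integral_eq_lintegral_of_nonneg_ae hpos hf, h, ENNReal.toReal_ofReal hc]

theorem Real.abs_log_le_add_inv {s : ℝ} (hs : 0 < s) : |Real.log s| ≤ s + s⁻¹ := by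
  have h1 := Real.log_le_sub_one_of_pos hs
  have h2 := Real.one_sub_inv_le_log_of_pos hs
  have h3 := inv_pos.2 hs
  rw [abs_le]
  constructor <;> linarith

namespace RandomX

theorem integrable_trace_gram_inv {n q : ℕ} (hq : q + 1 < n) :
    Integrable (fun U => (((Matrix.of U)ᵀ * Matrix.of U)⁻¹).trace) (stdMat n q) ∧
    ∫ U, (((Matrix.of U)ᵀ * Matrix.of U)⁻¹).trace ∂(stdMat n q) = q / ((n : ℝ) - q - 1) := by
  have hn : (q : ℝ) + 1 < n := by exact_mod_cast hq
  refine integrable_and_integral_eq_of_lintegral_ofReal ?_ ?_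
    (div_nonneg (by positivity) (by linarith)) (lintegral_trace_gram_inv hq)
  · exact (Finset.measurable_fun_sum _ fun j _ => measurable_gram_inv
      (fun i j => by simp only [Matrix.of_apply]; fun_prop) j j).aestronglyMeasurable
  · filter_upwards [ae_posDef_gram_stdMat hq] with U hU
    exact hU.inv.posSemidef.trace_nonneg

theorem integrable_inv_olsRss {n q : ℕ} (hq : q + 2 < n) :
    Integrable (fun z : (Fin n → Fin q → ℝ) × (Fin n → ℝ) => (olsRss (Matrix.of z.1) z.2)⁻¹)
      ((stdMat n q).prod (stdVec (Fin n))) ∧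
    ∫ z, (olsRss (Matrix.of z.1) z.2)⁻¹ ∂((stdMat n q).prod (stdVec (Fin n))) =
      1 / ((n : ℝ) - q - 2) := by
  have hn : (q : ℝ) + 2 < n := by exact_mod_cast hq
  refine integrable_and_integral_eq_of_lintegral_ofReal
    (measurable_olsRss_prod n q).inv.aestronglyMeasurable
    (ae_of_all _ fun z => inv_nonneg.2 (olsRss_nonneg _ _))
    (div_nonneg (by positivity) (by linarith)) ?_
  rw [← lintegral_inv_olsRss_prod hq]
  refine lintegral_congr_ae ?_
  filter_upwards [ae_prod_posDef_olsRss_pos hq (ae_posDef_gram_stdMat (by omega))] with z hz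
  rw [ENNReal.ofReal_inv_of_pos hz.2]

theorem integrable_betaFull_sq_div_olsRss {n q : ℕ} (hq : q + 2 < n) :
    Integrable (fun z : (Fin n → Fin q → ℝ) × (Fin n → ℝ) =>
      (∑ j, betaFull (Matrix.of z.1) z.2 j ^ 2) * (olsRss (Matrix.of z.1) z.2)⁻¹)
      ((stdMat n q).prod (stdVec (Fin n))) ∧
    ∫ z, (∑ j, betaFull (Matrix.of z.1) z.2 j ^ 2) * (olsRss (Matrix.of z.1) z.2)⁻¹
        ∂((stdMat n q).prod (stdVec (Fin n))) =
      q / ((n : ℝ) - q - 1) * (1 / ((n : ℝ) - q - 2)) := by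
  have hn : (q : ℝ) + 2 < n := by exact_mod_cast hq
  have hm3 : ∀ j, Measurable fun z : (Fin n → Fin q → ℝ) × (Fin n → ℝ) =>
      betaFull (Matrix.of z.1) z.2 j := fun j =>
    measurable_betaFull (fun i j => by simp only [Matrix.of_apply]; fun_prop)
      (fun i => by fun_prop) j
  refine integrable_and_integral_eq_of_lintegral_ofReal
    ((Finset.measurable_fun_sum _ fun j _ => (hm3 j).pow_const 2).mul
      (measurable_olsRss_prod n q).inv).aestronglyMeasurable
    (ae_of_all _ fun z => mul_nonneg (by positivity) (inv_nonneg.2 (olsRss_nonneg _ _)))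
    (mul_nonneg (div_nonneg (by positivity) (by linarith))
      (div_nonneg (by positivity) (by linarith))) ?_
  rw [← lintegral_betaFull_sq_div_olsRss_prod hq]
  refine lintegral_congr_ae ?_
  filter_upwards [ae_prod_posDef_olsRss_pos hq (ae_posDef_gram_stdMat (by omega))] with z hz
  rw [ENNReal.ofReal_mul (by positivity), ENNReal.ofReal_inv_of_pos hz.2]

theorem integrable_log_olsRss {n q : ℕ} (hq : q + 2 < n) :
    Integrable (fun z : (Fin n → Fin q → ℝ) × (Fin n → ℝ) =>
      Real.log (olsRss (Matrix.of z.1) z.2)) ((stdMat n q).prod (stdVec (Fin n))) := by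
  have hsq : Integrable (fun z : (Fin n → Fin q → ℝ) × (Fin n → ℝ) => ∑ i, z.2 i ^ 2)
      ((stdMat n q).prod (stdVec (Fin n))) := by
    refine Integrable.comp_snd (f := fun e : Fin n → ℝ => ∑ i, e i ^ 2) ?_ _
    refine integrable_finsetSum _ fun i _ => ?_
    simpa [sq] using (integral_mul_stdVec i i).1
  refine (hsq.add (integrable_inv_olsRss hq).1).mono'
    (measurable_olsRss_prod n q).log.aestronglyMeasurable ?_
  filter_upwards [ae_prod_posDef_olsRss_pos hq (ae_posDef_gram_stdMat (by omega))] with z hz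
  refine (Real.abs_log_le_add_inv hz.2).trans ?_
  -- Pythagoras at the zero coefficient bounds RSS by ‖e‖², so |log RSS| ≤ ‖e‖² + 1/RSS.
  have h1 := sum_sq_residual hz.1 z.2 0
  have h2 := hz.1.posSemidef.dotProduct_mulVec_nonneg (0 - betaFull (Matrix.of z.1) z.2)
  rw [star_trivial] at h2
  simp only [Matrix.mulVec_zero, Pi.zero_apply, sub_zero] at h1
  simp only [Pi.add_apply]
  linarith

theorem integrable_log_det_gram {n q : ℕ} (hq : q + 1 < n) :
    Integrable (fun U => Real.log ((Matrix.of U)ᵀ * Matrix.of U).det) (stdMat n q) := by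
  have hsq : Integrable (fun U : Fin n → Fin q → ℝ => ((Matrix.of U)ᵀ * Matrix.of U).trace)
      (stdMat n q) := by
    simp only [Matrix.trace, Matrix.diag, Matrix.mul_apply, Matrix.transpose_apply,
      Matrix.of_apply]
    refine integrable_finsetSum _ fun j _ => integrable_finsetSum _ fun i _ => ?_
    exact (measurePreserving_eval (fun _ : Fin n => stdVec (Fin q)) i).integrable_comp_of_integrable
      (integral_mul_stdVec j j).1
  refine (hsq.add (integrable_trace_gram_inv hq).1).mono'
    (measurable_gram_det fun i j => by
      simp only [Matrix.of_apply]; fun_prop).log.aestronglyMeasurable ?_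
  filter_upwards [ae_posDef_gram_stdMat hq] with U hU
  exact hU.abs_log_det_le

/-! ### The law of the Gaussian design and its second moments. -/

/-- The law of the design in orthonormal coordinates of a subspace, and of the scaled errors. -/
theorem IsGaussianDesign.hasLaw {n p q : ℕ} {Ω : Type*} [MeasurableSpace Ω] {P : Measure Ω}
    [IsProbabilityMeasure P] {x : Fin n → Ω → EuclideanSpace ℝ (Fin p)} {ε : Fin n → Ω → ℝ}
    {S : Matrix (Fin p) (Fin p) ℝ} {v : ℝ} (h : IsGaussianDesign P x ε S v) (hv : 0 < v)
    (hS : S.PosDef) {N : Matrix (Fin p) (Fin q) ℝ} (hN : Nᵀ * S * N = 1) :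
    HasLaw (fun ω => ((design x ω * N, fun i => ε i ω / √v) :
      (Fin n → Fin q → ℝ) × (Fin n → ℝ))) ((stdMat n q).prod (stdVec (Fin n))) P := by
  have h1 := h.indep_rows.hasLaw_pi h.law_row
  have h2 := h.indep_errs.hasLaw_pi h.law_err
  have h3 := h.indep.hasLaw_prod h1 h2
  have m1 := measurePreserving_pi (fun _ : Fin n => multivariateGaussian 0 S)
    (fun _ => stdVec (Fin q))
    (fun _ => measurePreserving_mulVec_multivariateGaussian hS.posSemidef hN)
  have m2 : MeasurePreserving (fun z : ℝ => z / √v) (gaussianReal 0 v.toNNReal)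
      (gaussianReal 0 1) := by
    refine ⟨by fun_prop, ?_⟩
    rw [gaussianReal_map_div_const, zero_div]
    congr 1
    ext
    simp [Real.sq_sqrt hv.le, hv.le, hv.ne']
  have m3 := measurePreserving_pi (fun _ : Fin n => gaussianReal 0 v.toNNReal)
    (fun _ => gaussianReal 0 1) (fun _ => m2)
  have h4 := (m1.prod m3).comp_hasLaw h3
  convert h4 using 1
  ext ω
  · simp only [Function.comp, Prod.map, Matrix.mul_apply, design, Matrix.of_apply, Matrix.mulVec,
      dotProduct, Matrix.transpose_apply, mul_comm]
  · rfl

section Moments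

variable {n p : ℕ} {Ω : Type*} [MeasurableSpace Ω] {P : Measure Ω}
  {x : Fin n → Ω → EuclideanSpace ℝ (Fin p)} {ε : Fin n → Ω → ℝ}
  {S : Matrix (Fin p) (Fin p) ℝ} {v : ℝ}

theorem memLp_two_eval_multivariateGaussian (j : Fin p) :
    MemLp (fun z : EuclideanSpace ℝ (Fin p) => z j) 2 (multivariateGaussian 0 S) :=
  (EuclideanSpace.proj (𝕜 := ℝ) j).comp_memLp' IsGaussian.memLp_two_id

theorem integral_eval_multivariateGaussian (j : Fin p) :
    ∫ z : EuclideanSpace ℝ (Fin p), z j ∂(multivariateGaussian 0 S) = 0 := by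
  have := (EuclideanSpace.proj (𝕜 := ℝ) j).integral_comp_comm
    (IsGaussian.integrable_fun_id (μ := multivariateGaussian (0 : EuclideanSpace ℝ (Fin p)) S))
  simpa using this

theorem IsGaussianDesign.memLp_row (h : IsGaussianDesign P x ε S v) (i : Fin n) (j : Fin p) :
    MemLp (fun ω => x i ω j) 2 P := by
  have := memLp_two_eval_multivariateGaussian (S := S) j
  rw [← (h.law_row i).map_eq] at this
  exact this.comp_of_map (h.law_row i).aemeasurable

theorem IsGaussianDesign.memLp_err (h : IsGaussianDesign P x ε S v) (i : Fin n) :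
    MemLp (ε i) 2 P := by
  have := memLp_id_gaussianReal (μ := 0) (v := v.toNNReal) 2
  rw [← (h.law_err i).map_eq] at this
  exact this.comp_of_map (h.law_err i).aemeasurable

theorem IsGaussianDesign.integral_row_mul (h : IsGaussianDesign P x ε S v) (hS : S.PosDef)
    (i : Fin n) (j k : Fin p) : ∫ ω, x i ω j * x i ω k ∂P = S j k := by
  have h1 := (h.law_row i).integral_comp
    (f := fun z : EuclideanSpace ℝ (Fin p) => z j * z k) (by fun_prop)
  have h2 := covariance_eval_multivariateGaussian (μ := 0) hS.posSemidef j k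
  rw [covariance_eq_sub (memLp_two_eval_multivariateGaussian j)
    (memLp_two_eval_multivariateGaussian k), integral_eval_multivariateGaussian, zero_mul,
    sub_zero] at h2
  exact h1.trans h2

theorem IsGaussianDesign.integral_err_sq (h : IsGaussianDesign P x ε S v) (hv : 0 < v)
    (i : Fin n) : ∫ ω, ε i ω ^ 2 ∂P = v := by
  have h1 := (h.law_err i).integral_comp (f := fun z : ℝ => z ^ 2) (by fun_prop)
  have h2 := variance_id_gaussianReal (μ := 0) (v := v.toNNReal)
  rw [variance_eq_sub (memLp_id_gaussianReal 2)] at h2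
  simp only [Pi.pow_apply, id, integral_id_gaussianReal, Real.coe_toNNReal _ hv.le] at h2
  exact h1.trans (by simpa using h2)

theorem IsGaussianDesign.integral_row_mul_err (h : IsGaussianDesign P x ε S v)
    (i : Fin n) (j : Fin p) : ∫ ω, x i ω j * ε i ω ∂P = 0 := by
  have hind : IndepFun (fun ω => x i ω j) (ε i) P :=
    h.indep.comp (φ := fun z : Fin n → EuclideanSpace ℝ (Fin p) => z i j)
      (ψ := fun e : Fin n → ℝ => e i) (by fun_prop) (by fun_prop)
  rw [hind.integral_fun_mul_eq_mul_integral (h.memLp_row i j).1 (h.memLp_err i).1]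
  have h1 := (h.law_err i).integral_comp (f := fun z : ℝ => z) (by fun_prop)
  have h2 : ∫ ω, ε i ω ∂P = 0 := h1.trans integral_id_gaussianReal
  rw [h2, mul_zero]

theorem IsGaussianDesign.integral_trace (h : IsGaussianDesign P x ε S v) (hS : S.PosDef)
    (M : Matrix (Fin p) (Fin p) ℝ) :
    Integrable (fun ω => (M * ((design x ω)ᵀ * design x ω)).trace) P ∧
    ∫ ω, (M * ((design x ω)ᵀ * design x ω)).trace ∂P = n * (M * S).trace := by
  have hexp : ∀ ω, (M * ((design x ω)ᵀ * design x ω)).trace =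
      ∑ j, ∑ k, ∑ i, M j k * (x i ω k * x i ω j) := by
    intro ω
    simp only [Matrix.trace, Matrix.diag, Matrix.mul_apply, Matrix.transpose_apply, design,
      Matrix.of_apply, Finset.mul_sum]
  have i1 : ∀ j k i, Integrable (fun ω => M j k * (x i ω k * x i ω j)) P := fun j k i =>
    ((h.memLp_row i k).integrable_mul (h.memLp_row i j)).const_mul _
  simp_rw [hexp]
  refine ⟨integrable_finsetSum _ fun j _ => integrable_finsetSum _ fun k _ =>
    integrable_finsetSum _ fun i _ => i1 j k i, ?_⟩
  rw [integral_finsetSum _ fun j _ => integrable_finsetSum _ fun k _ =>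
    integrable_finsetSum _ fun i _ => i1 j k i, Matrix.trace, Finset.mul_sum]
  refine Finset.sum_congr rfl fun j _ => ?_
  rw [integral_finsetSum _ fun k _ => integrable_finsetSum _ fun i _ => i1 j k i, Matrix.diag,
    Matrix.mul_apply, Finset.mul_sum]
  refine Finset.sum_congr rfl fun k _ => ?_
  rw [integral_finsetSum _ fun i _ => i1 j k i]
  simp_rw [integral_const_mul, h.integral_row_mul hS]
  simp

theorem IsGaussianDesign.integral_residual_sq (h : IsGaussianDesign P x ε S v) (hS : S.PosDef)
    (hv : 0 < v) (d : Fin p → ℝ) (i : Fin n) :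
    Integrable (fun ω => (ε i ω - ∑ j, x i ω j * d j) ^ 2) P ∧
    ∫ ω, (ε i ω - ∑ j, x i ω j * d j) ^ 2 ∂P = v + d ⬝ᵥ (S *ᵥ d) := by
  -- Expanding the square isolates the cross term, whose mean is zero because errors and rows are
  -- independent and centred.
  have hexp : ∀ ω, (ε i ω - ∑ j, x i ω j * d j) ^ 2 = ε i ω ^ 2
      - ∑ j, (2 * d j) * (x i ω j * ε i ω) + ∑ j, ∑ k, (d j * d k) * (x i ω j * x i ω k) := by
    intro ω
    have h1 : ∑ j, (2 * d j) * (x i ω j * ε i ω) = 2 * ε i ω * ∑ j, x i ω j * d j := by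
      rw [Finset.mul_sum]; exact Finset.sum_congr rfl fun j _ => by ring
    have h2 : ∑ j, ∑ k, (d j * d k) * (x i ω j * x i ω k) =
        (∑ j, x i ω j * d j) * ∑ j, x i ω j * d j := by
      rw [Finset.sum_mul_sum]
      exact Finset.sum_congr rfl fun j _ => Finset.sum_congr rfl fun k _ => by ring
    rw [h1, h2]; ring
  have i1 : Integrable (fun ω => ε i ω ^ 2) P := (h.memLp_err i).integrable_sq
  have i2 : ∀ j, Integrable (fun ω => (2 * d j) * (x i ω j * ε i ω)) P := fun j =>
    ((h.memLp_row i j).integrable_mul (h.memLp_err i)).const_mul _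
  have i3 : ∀ j k, Integrable (fun ω => (d j * d k) * (x i ω j * x i ω k)) P := fun j k =>
    ((h.memLp_row i j).integrable_mul (h.memLp_row i k)).const_mul _
  have i2' := integrable_finsetSum Finset.univ fun j _ => i2 j
  have i3' := integrable_finsetSum Finset.univ fun j _ =>
    integrable_finsetSum Finset.univ fun k _ => i3 j k
  simp_rw [hexp]
  refine ⟨(i1.sub i2').add i3', ?_⟩
  rw [integral_add (by exact i1.sub i2') i3', integral_sub i1 i2', integral_finsetSum _ fun j _ => i2 j,
    integral_finsetSum _ fun j _ => integrable_finsetSum Finset.univ fun k _ => i3 j k]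
  have h3 : ∀ j, ∫ ω, ∑ k, (d j * d k) * (x i ω j * x i ω k) ∂P = ∑ k, d j * d k * S j k := by
    intro j
    rw [integral_finsetSum _ fun k _ => i3 j k]
    simp_rw [integral_const_mul, h.integral_row_mul hS]
  simp_rw [h3, integral_const_mul, h.integral_row_mul_err, h.integral_err_sq hv]
  simp only [mul_zero, Finset.sum_const_zero, sub_zero, dotProduct, Matrix.mulVec,
    Finset.mul_sum, add_right_inj]
  exact Finset.sum_congr rfl fun j _ => Finset.sum_congr rfl fun k _ => by ring

variable [IsProbabilityMeasure P]

/-- The expected value of `-2 log f` at a sample from the true model. -/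
theorem IsGaussianDesign.integral_negTwoLogLik (h : IsGaussianDesign P x ε S v) (hS : S.PosDef)
    (hv : 0 < v) (β₀ : Fin p → ℝ) (θ : Params p) (hvar : 0 < θ.var) (hcov : θ.cov.PosDef) :
    Integrable (fun ω => negTwoLogLik (design x ω) (response x ε β₀ ω) θ) P ∧
    ∫ ω, negTwoLogLik (design x ω) (response x ε β₀ ω) θ ∂P =
      n * Real.log (2 * Real.pi * θ.var)
        + n * (v + (θ.β - β₀) ⬝ᵥ (S *ᵥ (θ.β - β₀))) / θ.var + n * p * Real.log (2 * Real.pi)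
        + n * Real.log θ.cov.det + n * (θ.cov⁻¹ * S).trace := by
  have hres : ∀ ω i, response x ε β₀ ω i - (design x ω *ᵥ θ.β) i =
      ε i ω - ∑ j, x i ω j * (θ.β - β₀) j := by
    intro ω i
    have : ∑ j, x i ω j * (θ.β - β₀) j = (design x ω *ᵥ (θ.β - β₀)) i := rfl
    rw [this, Matrix.mulVec_sub, response, Pi.sub_apply]
    ring
  have hr := fun i => h.integral_residual_sq hS hv (θ.β - β₀) i
  obtain ⟨t1, t2⟩ := h.integral_trace hS θ.cov⁻¹
  have i1 := (integrable_finsetSum Finset.univ fun i _ => (hr i).1).div_const θ.var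
  simp_rw [negTwoLogLik_eq _ _ θ hvar hcov, hres]
  have i2 := ((((integrable_const (μ := P) (n * Real.log (2 * Real.pi * θ.var))).add i1).add
    (integrable_const (n * p * Real.log (2 * Real.pi)))).add
    (integrable_const (n * Real.log θ.cov.det)))
  refine ⟨i2.add t1, ?_⟩
  have e1 : ∫ ω, (n * Real.log (2 * Real.pi * θ.var)
      + (∑ i, (ε i ω - ∑ j, x i ω j * (θ.β - β₀) j) ^ 2) / θ.var
      + n * p * Real.log (2 * Real.pi) + n * Real.log θ.cov.det) ∂P =
      n * Real.log (2 * Real.pi * θ.var)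
        + n * (v + (θ.β - β₀) ⬝ᵥ (S *ᵥ (θ.β - β₀))) / θ.var + n * p * Real.log (2 * Real.pi)
        + n * Real.log θ.cov.det := by
    rw [integral_add (by exact ((integrable_const _).add i1).add (integrable_const _))
      (integrable_const _),
      integral_add (by exact (integrable_const _).add i1) (integrable_const _),
      integral_add (integrable_const _) i1, integral_div, integral_finsetSum _ fun i _ => (hr i).1]
    simp_rw [(hr _).2]
    simp
    ring
  rw [← t2, ← e1]
  exact integral_add i2 t1

end Moments

/-! ### Scaling, whitening, and closed forms of the training and test errors. -/

theorem betaFull_smul {n q : ℕ} (U : Matrix (Fin n) (Fin q) ℝ) (c : ℝ) (e : Fin n → ℝ) :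
    betaFull U (c • e) = c • betaFull U e := by
  simp only [betaFull, Matrix.mulVec_smul]

theorem olsRss_smul {n q : ℕ} (U : Matrix (Fin n) (Fin q) ℝ) (c : ℝ) (e : Fin n → ℝ) :
    olsRss U (c • e) = c ^ 2 * olsRss U e := by
  simp only [olsRss, betaFull_smul, Matrix.mulVec_smul, Finset.mul_sum, Pi.smul_apply, smul_eq_mul]
  exact Finset.sum_congr rfl fun i _ => by ring

theorem isUnit_det_of_transpose_mul_mul_eq_one {p : ℕ} {S N : Matrix (Fin p) (Fin p) ℝ}
    (hN : Nᵀ * S * N = 1) : IsUnit N.det :=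
  Matrix.isUnit_det_of_left_inverse hN

theorem _root_.Matrix.PosDef.exists_transpose_mul_mul_eq_one {p : ℕ}
    {S : Matrix (Fin p) (Fin p) ℝ} (hS : S.PosDef) :
    ∃ N : Matrix (Fin p) (Fin p) ℝ, Nᵀ * S * N = 1 := by
  obtain ⟨B, hB, hSB⟩ := hS.exists_transpose_mul_self
  have hBd := (Matrix.isUnit_iff_isUnit_det B).1 hB
  refine ⟨B⁻¹, ?_⟩
  rw [hSB, ← Matrix.mul_assoc, ← Matrix.transpose_mul, Matrix.mul_nonsing_inv _ hBd,
    Matrix.transpose_one, Matrix.one_mul, Matrix.mul_nonsing_inv _ hBd]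

theorem det_gram_mul {n p : ℕ} (X : Matrix (Fin n) (Fin p) ℝ) (N : Matrix (Fin p) (Fin p) ℝ) :
    ((X * N)ᵀ * (X * N)).det = N.det ^ 2 * (Xᵀ * X).det := by
  rw [show (X * N)ᵀ * (X * N) = Nᵀ * (Xᵀ * X) * N by
    rw [Matrix.transpose_mul]; simp only [Matrix.mul_assoc]]
  rw [Matrix.det_mul, Matrix.det_mul, Matrix.det_transpose]
  ring

/-- Here S = N⁻ᵀN⁻¹, and cyclicity of the trace moves the whitening into the design. It expresses
the covariance part of the test error through a standard Gaussian matrix. -/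
theorem trace_gram_inv_mul {n p : ℕ} (X : Matrix (Fin n) (Fin p) ℝ)
    {S N : Matrix (Fin p) (Fin p) ℝ} (hN : Nᵀ * S * N = 1) :
    ((Xᵀ * X)⁻¹ * S).trace = (((X * N)ᵀ * (X * N))⁻¹).trace := by
  have hd := isUnit_det_of_transpose_mul_mul_eq_one hN
  have hS : S = (Nᵀ)⁻¹ * N⁻¹ := by
    have h1 : Nᵀ * S = N⁻¹ := (Matrix.inv_eq_left_inv hN).symm
    rw [← h1, ← Matrix.mul_assoc, Matrix.nonsing_inv_mul _ (by rwa [Matrix.det_transpose]),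
      Matrix.one_mul]
  rw [show (X * N)ᵀ * (X * N) = Nᵀ * (Xᵀ * X) * N by
    rw [Matrix.transpose_mul]; simp only [Matrix.mul_assoc]]
  rw [Matrix.mul_inv_rev, Matrix.mul_inv_rev, Matrix.trace_mul_comm N⁻¹, hS]
  simp only [Matrix.mul_assoc]

section Errors

variable {n p m q : ℕ} {X : Matrix (Fin n) (Fin p) ℝ} {N : Matrix (Fin p) (Fin q) ℝ}
    {R : Matrix (Fin m) (Fin p) ℝ} {S : Matrix (Fin p) (Fin p) ℝ}

theorem mle_mem (hn : 0 < n) (hX : (Xᵀ * X).PosDef)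
    (hR : R.rank = m) (hRN : R * N = 0) (hN : Nᵀ * S * N = 1)
    (hker : ∀ v, R *ᵥ v = 0 → ∃ c, v = N *ᵥ c) (β₀ : Fin p → ℝ) (e : Fin n → ℝ)
    (hrss : 0 < olsRss (X * N) e) :
    0 < (mle R (R *ᵥ β₀) X (X *ᵥ β₀ + e)).var ∧
      (mle R (R *ᵥ β₀) X (X *ᵥ β₀ + e)).cov.PosDef :=
  ((isRestrictedMLE_iff hn hX hR hRN hN hker β₀ e hrss _).2 rfl).1.2

theorem trainErr_eq (hn : 0 < n) (hX : (Xᵀ * X).PosDef)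
    (hR : R.rank = m) (hRN : R * N = 0) (hN : Nᵀ * S * N = 1)
    (hker : ∀ v, R *ᵥ v = 0 → ∃ c, v = N *ᵥ c) (β₀ : Fin p → ℝ) (e : Fin n → ℝ)
    (hrss : 0 < olsRss (X * N) e) :
    trainErr R (R *ᵥ β₀) X (X *ᵥ β₀ + e) =
      n * Real.log (2 * Real.pi * (olsRss (X * N) e / n)) + n + n * p * Real.log (2 * Real.pi)
        + n * Real.log ((n : ℝ)⁻¹ • (Xᵀ * X)).det + n * p := by
  have hn' : (0 : ℝ) < n := by exact_mod_cast hn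
  obtain ⟨hv, hcov⟩ := mle_mem hn hX hR hRN hN hker β₀ e hrss
  rw [trainErr, negTwoLogLik_eq _ _ _ hv hcov]
  have hr := rss_eq hX hR hRN hN hker β₀ e
  have e1 : ∑ i, ((X *ᵥ β₀ + e) i - (X *ᵥ (mle R (R *ᵥ β₀) X (X *ᵥ β₀ + e)).β) i) ^ 2 =
      olsRss (X * N) e := hr
  have e2 : (mle R (R *ᵥ β₀) X (X *ᵥ β₀ + e)).var = olsRss (X * N) e / n := by
    rw [← hr]; rfl
  have e3 : (mle R (R *ᵥ β₀) X (X *ᵥ β₀ + e)).cov = (n : ℝ)⁻¹ • (Xᵀ * X) := rfl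
  rw [e3] at hcov
  have e4 : (((n : ℝ)⁻¹ • (Xᵀ * X))⁻¹ * (Xᵀ * X)).trace = n * p := by
    have : Xᵀ * X = (n : ℝ) • ((n : ℝ)⁻¹ • (Xᵀ * X)) := by
      rw [smul_smul, mul_inv_cancel₀ hn'.ne', one_smul]
    conv_lhs => enter [1, 2]; rw [this]
    rw [Matrix.mul_smul, Matrix.nonsing_inv_mul _ ((Matrix.isUnit_iff_isUnit_det _).1 hcov.isUnit)]
    simp
  rw [e1, e2, e3, e4]
  congr 4
  field_simp

/-- Two coordinate systems are used: `N` on the kernel of R, where the S-norm of β̂ - β₀ = N b is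
the Euclidean norm of b, and `N₀` on all of ℝᵖ for the unrestricted covariance estimate. -/
theorem testErr_eq {Ω : Type*} [MeasurableSpace Ω] {P : Measure Ω} [IsProbabilityMeasure P]
    {x' : Fin n → Ω → EuclideanSpace ℝ (Fin p)} {ε' : Fin n → Ω → ℝ} {v : ℝ}
    (h : IsGaussianDesign P x' ε' S v) (hS : S.PosDef) (hv : 0 < v) (hn : 0 < n)
    (hX : (Xᵀ * X).PosDef)
    (hR : R.rank = m) (hRN : R * N = 0) (hN : Nᵀ * S * N = 1)
    (hker : ∀ v, R *ᵥ v = 0 → ∃ c, v = N *ᵥ c) (β₀ : Fin p → ℝ) (e : Fin n → ℝ)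
    (hrss : 0 < olsRss (X * N) e) {N₀ : Matrix (Fin p) (Fin p) ℝ} (hN₀ : N₀ᵀ * S * N₀ = 1) :
    testErr P (design x') (response x' ε' β₀) R (R *ᵥ β₀) X (X *ᵥ β₀ + e) =
      n * Real.log (2 * Real.pi * (olsRss (X * N) e / n))
        + n ^ 2 * (v + ∑ j, betaFull (X * N) e j ^ 2) * (olsRss (X * N) e)⁻¹
        + n * p * Real.log (2 * Real.pi)
        + n * Real.log ((n : ℝ)⁻¹ • (Xᵀ * X)).det
        + n ^ 2 * (((X * N₀)ᵀ * (X * N₀))⁻¹).trace := by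
  have hn' : (0 : ℝ) < n := by exact_mod_cast hn
  obtain ⟨hvar, hcov⟩ := mle_mem hn hX hR hRN hN hker β₀ e hrss
  rw [testErr, (h.integral_negTwoLogLik hS hv β₀ _ hvar hcov).2]
  have e1 : (mle R (R *ᵥ β₀) X (X *ᵥ β₀ + e)).β - β₀ = N *ᵥ betaFull (X * N) e := by
    change betaHat R (R *ᵥ β₀) X (X *ᵥ β₀ + e) - β₀ = _
    rw [betaHat_eq hX hR hRN hN hker]; abel
  have e2 : (mle R (R *ᵥ β₀) X (X *ᵥ β₀ + e)).var = olsRss (X * N) e / n := by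
    rw [← rss_eq hX hR hRN hN hker β₀ e]; rfl
  have e3 : (mle R (R *ᵥ β₀) X (X *ᵥ β₀ + e)).cov = (n : ℝ)⁻¹ • (Xᵀ * X) := rfl
  have e4 : ((N *ᵥ betaFull (X * N) e) ⬝ᵥ (S *ᵥ (N *ᵥ betaFull (X * N) e))) =
      ∑ j, betaFull (X * N) e j ^ 2 := by
    rw [Matrix.mulVec_mulVec, ← Matrix.vecMul_transpose, ← Matrix.dotProduct_mulVec,
      Matrix.mulVec_mulVec, ← Matrix.mul_assoc, hN, Matrix.one_mulVec, sum_sq_eq_dotProduct]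
  have e5 : (((n : ℝ)⁻¹ • (Xᵀ * X))⁻¹ * S).trace = n * (((X * N₀)ᵀ * (X * N₀))⁻¹).trace := by
    rw [← trace_gram_inv_mul X hN₀]
    have := Matrix.inv_smul' (Xᵀ * X) (Units.mk0 (n : ℝ)⁻¹ (by positivity))
      ((Matrix.isUnit_iff_isUnit_det _).1 hX.isUnit)
    simp only [Units.smul_def, Units.val_mk0, Units.val_inv_eq_inv_val, inv_inv] at this
    rw [this, Matrix.smul_mul, Matrix.trace_smul, smul_eq_mul]
  rw [e1, e2, e3, e4, e5]
  have := hrss.ne'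
  congr 1
  · congr 3
    field_simp
  · ring

end Errors

/-! ### Transfer of the moments to the design and the scaled errors. -/

/-- The errors scaled to unit variance. -/
noncomputable def stdErr {n : ℕ} {Ω : Type*} (ε : Fin n → Ω → ℝ) (v : ℝ) (ω : Ω) : Fin n → ℝ :=
  fun i => ε i ω / √v

theorem smul_stdErr {n : ℕ} {Ω : Type*} (ε : Fin n → Ω → ℝ) {v : ℝ} (hv : 0 < v) (ω : Ω) :
    √v • stdErr ε v ω = fun i => ε i ω := by
  ext i
  have : √v ≠ 0 := (Real.sqrt_pos.2 hv).ne'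
  simp only [stdErr, Pi.smul_apply, smul_eq_mul]
  field_simp

section Design

variable {n p q : ℕ} {Ω : Type*} [MeasurableSpace Ω] {P : Measure Ω} [IsProbabilityMeasure P]
  {x : Fin n → Ω → EuclideanSpace ℝ (Fin p)} {ε : Fin n → Ω → ℝ}
  {S : Matrix (Fin p) (Fin p) ℝ} {v : ℝ}

theorem IsGaussianDesign.hasLaw_design (h : IsGaussianDesign P x ε S v) (hv : 0 < v)
    (hS : S.PosDef) {N : Matrix (Fin p) (Fin q) ℝ} (hN : Nᵀ * S * N = 1) :
    HasLaw (fun ω => (design x ω * N : Fin n → Fin q → ℝ)) (stdMat n q) P :=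
  measurePreserving_fst.comp_hasLaw (h.hasLaw hv hS hN)

theorem IsGaussianDesign.ae_posDef_gram (h : IsGaussianDesign P x ε S v) (hv : 0 < v)
    (hS : S.PosDef) (hn : p + 1 < n) : ∀ᵐ ω ∂P, ((design x ω)ᵀ * design x ω).PosDef := by
  obtain ⟨N, hN⟩ := hS.exists_transpose_mul_mul_eq_one
  have law := h.hasLaw_design hv hS hN
  have h1 := ae_posDef_gram_stdMat hn
  rw [← law.map_eq] at h1
  filter_upwards [ae_of_ae_map law.aemeasurable h1] with ω hω
  have h2 : ((design x ω * N)ᵀ * (design x ω * N)).PosDef := hω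
  refine Matrix.posDef_transpose_mul_self_of_det_ne_zero fun h0 => h2.det_pos.ne' ?_
  rw [det_gram_mul, h0, mul_zero]

variable {N : Matrix (Fin p) (Fin q) ℝ}

theorem IsGaussianDesign.ae_olsRss_pos (h : IsGaussianDesign P x ε S v) (hv : 0 < v)
    (hS : S.PosDef) (hN : Nᵀ * S * N = 1) (hq : q + 2 < n) :
    ∀ᵐ ω ∂P, 0 < olsRss (design x ω * N) (stdErr ε v ω) := by
  have law := h.hasLaw hv hS hN
  have h1 := ae_prod_posDef_olsRss_pos hq (ae_posDef_gram_stdMat (by omega))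
  rw [← law.map_eq] at h1
  filter_upwards [ae_of_ae_map law.aemeasurable h1] with ω hω
  exact hω.2

theorem IsGaussianDesign.integrable_trace_gram_inv (h : IsGaussianDesign P x ε S v) (hv : 0 < v)
    (hS : S.PosDef) (hN : Nᵀ * S * N = 1) (hq : q + 1 < n) :
    Integrable (fun ω => (((design x ω * N)ᵀ * (design x ω * N))⁻¹).trace) P ∧
    ∫ ω, (((design x ω * N)ᵀ * (design x ω * N))⁻¹).trace ∂P = q / ((n : ℝ) - q - 1) := by
  have law := h.hasLaw_design hv hS hN
  obtain ⟨h1, h2⟩ := RandomX.integrable_trace_gram_inv hq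
  refine ⟨?_, (law.integral_comp h1.1).trans h2⟩
  rw [← law.map_eq] at h1
  exact h1.comp_aemeasurable law.aemeasurable

theorem IsGaussianDesign.integrable_log_det_gram (h : IsGaussianDesign P x ε S v) (hv : 0 < v)
    (hS : S.PosDef) (hN : Nᵀ * S * N = 1) (hq : q + 1 < n) :
    Integrable (fun ω => Real.log ((design x ω * N)ᵀ * (design x ω * N)).det) P := by
  have law := h.hasLaw_design hv hS hN
  have h1 := RandomX.integrable_log_det_gram hq
  rw [← law.map_eq] at h1
  exact h1.comp_aemeasurable law.aemeasurable

theorem IsGaussianDesign.integrable_inv_olsRss (h : IsGaussianDesign P x ε S v) (hv : 0 < v)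
    (hS : S.PosDef) (hN : Nᵀ * S * N = 1) (hq : q + 2 < n) :
    Integrable (fun ω => (olsRss (design x ω * N) (stdErr ε v ω))⁻¹) P ∧
    ∫ ω, (olsRss (design x ω * N) (stdErr ε v ω))⁻¹ ∂P = 1 / ((n : ℝ) - q - 2) := by
  have law := h.hasLaw hv hS hN
  obtain ⟨h1, h2⟩ := RandomX.integrable_inv_olsRss hq
  refine ⟨?_, (law.integral_comp h1.1).trans h2⟩
  rw [← law.map_eq] at h1
  exact h1.comp_aemeasurable law.aemeasurable

theorem IsGaussianDesign.integrable_betaFull_sq_div_olsRss (h : IsGaussianDesign P x ε S v)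
    (hv : 0 < v) (hS : S.PosDef) (hN : Nᵀ * S * N = 1) (hq : q + 2 < n) :
    Integrable (fun ω => (∑ j, betaFull (design x ω * N) (stdErr ε v ω) j ^ 2) *
      (olsRss (design x ω * N) (stdErr ε v ω))⁻¹) P ∧
    ∫ ω, (∑ j, betaFull (design x ω * N) (stdErr ε v ω) j ^ 2) *
      (olsRss (design x ω * N) (stdErr ε v ω))⁻¹ ∂P =
      q / ((n : ℝ) - q - 1) * (1 / ((n : ℝ) - q - 2)) := by
  have law := h.hasLaw hv hS hN
  obtain ⟨h1, h2⟩ := RandomX.integrable_betaFull_sq_div_olsRss hq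
  refine ⟨?_, (law.integral_comp h1.1).trans h2⟩
  rw [← law.map_eq] at h1
  exact h1.comp_aemeasurable law.aemeasurable

theorem IsGaussianDesign.integrable_log_olsRss (h : IsGaussianDesign P x ε S v) (hv : 0 < v)
    (hS : S.PosDef) (hN : Nᵀ * S * N = 1) (hq : q + 2 < n) :
    Integrable (fun ω => Real.log (olsRss (design x ω * N) (stdErr ε v ω))) P := by
  have law := h.hasLaw hv hS hN
  have h1 := RandomX.integrable_log_olsRss hq
  rw [← law.map_eq] at h1
  exact h1.comp_aemeasurable law.aemeasurable

end Design

end RandomX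

/-! ### Assembly of the main theorem. -/

theorem mainTheorem3 {n p m : ℕ} {Ω Ω' : Type*} [MeasurableSpace Ω] [MeasurableSpace Ω']
    (P : Measure Ω) [IsProbabilityMeasure P] (P' : Measure Ω') [IsProbabilityMeasure P']
    (x : Fin n → Ω → EuclideanSpace ℝ (Fin p)) (ε : Fin n → Ω → ℝ)
    (x' : Fin n → Ω' → EuclideanSpace ℝ (Fin p)) (ε' : Fin n → Ω' → ℝ)
    (β₀ : Fin p → ℝ) (σ₀sq : ℝ) (S₀ : Matrix (Fin p) (Fin p) ℝ)
    (R : Matrix (Fin m) (Fin p) ℝ) (r : Fin m → ℝ)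
    (hσ₀ : 0 < σ₀sq) (hS₀ : S₀.PosDef)
    -- the training sample, and the new sample with the same distribution
    (htrain : IsGaussianDesign P x ε S₀ σ₀sq)
    (hnew : IsGaussianDesign P' x' ε' S₀ σ₀sq)
    -- the restrictions are linearly independent and the true model satisfies them
    (hR : R.rank = m) (hβ₀ : R *ᵥ β₀ = r)
    -- the denominators in the claim are positive
    (hn : p + 1 < n) (hnm : p + 2 < n + m) :
    let X := design x
    let y := response x ε β₀
    let X' := design x'
    let y' := response x' ε' β₀
    -- almost surely, the joint MLE exists, is unique and has the closed form `mle`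
    (∀ᵐ ω ∂P, ∀ θ, IsRestrictedMLE R r (X ω) (y ω) θ ↔ θ = mle R r (X ω) (y ω)) ∧
    -- all expectations are finite
    (∀ᵐ ω ∂P, Integrable
      (fun ω' => negTwoLogLik (X' ω') (y' ω') (mle R r (X ω) (y ω))) P') ∧
    Integrable (fun ω => testErr P' X' y' R r (X ω) (y ω)) P ∧
    Integrable (fun ω => trainErr R r (X ω) (y ω)) P ∧
    -- the expected optimism
    (∫ ω, optimism P' X' y' R r (X ω) (y ω) ∂P =
      n * ((n * (n - 1)) / (((n : ℝ) - p + m - 2) * ((n : ℝ) - p + m - 1)))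
        + n * ((n * p) / ((n : ℝ) - p - 1)) - n * (p + 1)) ∧
    -- training error plus expected optimism is RAICc plus a term free of the restrictions, and it
    -- is an unbiased estimator of the expected test error
    (∀ᵐ ω ∂P, trainErr R r (X ω) (y ω) + ∫ ω₁, optimism P' X' y' R r (X ω₁) (y ω₁) ∂P =
      raicc R r (X ω) (y ω) + restrictionFree (X ω)) ∧
    Integrable (fun ω => raicc R r (X ω) (y ω) + restrictionFree (X ω)) P ∧
    (∫ ω, (raicc R r (X ω) (y ω) + restrictionFree (X ω)) ∂P =
      ∫ ω, testErr P' X' y' R r (X ω) (y ω) ∂P) := by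
  intro X y X' y'
  subst hβ₀
  let e := stdErr ε σ₀sq
  have hn0 : 0 < n := by omega
  have hnR : (0 : ℝ) < n := by exact_mod_cast hn0
  have hmp : m ≤ p := by
    rw [← hR]; simpa using Matrix.rank_le_width R
  -- Since m ≤ p the truncated subtraction is exact, and `hnm` becomes q + 2 < n, the condition for
  -- a finite inverse chi-squared mean.
  obtain ⟨q, hq, N, hRN, hN, hker⟩ : ∃ q, q = p - m ∧ ∃ N : Matrix (Fin p) (Fin q) ℝ,
      R * N = 0 ∧ Nᵀ * S₀ * N = 1 ∧ ∀ v, R *ᵥ v = 0 → ∃ c, v = N *ᵥ c :=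
    ⟨_, rfl, Matrix.exists_orthonormal_ker hS₀ R hR⟩
  have hqn : q + 2 < n := by omega
  have hqR : (q : ℝ) = p - m := by rw [hq, Nat.cast_sub hmp]
  have hqnR : (q : ℝ) + 2 < n := by exact_mod_cast hqn
  have hpnR : (p : ℝ) + 1 < n := by exact_mod_cast hn
  obtain ⟨N₀, hN₀⟩ := hS₀.exists_transpose_mul_mul_eq_one
  have hN₀d : N₀.det ≠ 0 := (isUnit_det_of_transpose_mul_mul_eq_one hN₀).ne_zero
  have hy : ∀ ω, y ω = X ω *ᵥ β₀ + √σ₀sq • e ω := fun ω => by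
    rw [smul_stdErr ε hσ₀]; rfl
  have hsq : √σ₀sq ^ 2 = σ₀sq := Real.sq_sqrt hσ₀.le
  have hpd : ∀ᵐ ω ∂P, ((X ω)ᵀ * X ω).PosDef := htrain.ae_posDef_gram hσ₀ hS₀ hn
  have hrpos : ∀ᵐ ω ∂P, 0 < olsRss (X ω * N) (e ω) := htrain.ae_olsRss_pos hσ₀ hS₀ hN hqn
  have hrpos' : ∀ ω, 0 < olsRss (X ω * N) (e ω) → 0 < olsRss (X ω * N) (√σ₀sq • e ω) := by
    intro ω h
    rw [olsRss_smul, hsq]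
    positivity
  obtain ⟨iT, mT⟩ := htrain.integrable_trace_gram_inv hσ₀ hS₀ hN₀ hn
  have iD := htrain.integrable_log_det_gram hσ₀ hS₀ hN₀ hn
  obtain ⟨iI, mI⟩ := htrain.integrable_inv_olsRss hσ₀ hS₀ hN hqn
  obtain ⟨iB, mB⟩ := htrain.integrable_betaFull_sq_div_olsRss hσ₀ hS₀ hN hqn
  have iL := htrain.integrable_log_olsRss hσ₀ hS₀ hN hqn
  -- the training error
  have htr : (fun ω => trainErr R (R *ᵥ β₀) (X ω) (y ω)) =ᵐ[P] fun ω =>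
      n * Real.log (olsRss (X ω * N) (e ω))
        + n * Real.log ((X ω * N₀)ᵀ * (X ω * N₀)).det
        + (n * Real.log (2 * Real.pi * (σ₀sq / n)) + n + n * p * Real.log (2 * Real.pi)
          + n * (Real.log ((n : ℝ)⁻¹ ^ p) - Real.log (N₀.det ^ 2)) + n * p) := by
    filter_upwards [hpd, hrpos] with ω h1 h2
    rw [hy, trainErr_eq hn0 h1 hR hRN hN hker β₀ _ (hrpos' ω h2), olsRss_smul, hsq,
      det_gram_mul, Matrix.det_smul, Fintype.card_fin]
    have e1 : Real.log (2 * Real.pi * (σ₀sq * olsRss (X ω * N) (e ω) / n)) =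
        Real.log (2 * Real.pi * (σ₀sq / n)) + Real.log (olsRss (X ω * N) (e ω)) := by
      rw [← Real.log_mul (by positivity) h2.ne']
      congr 1
      ring
    rw [e1, Real.log_mul (x := (n : ℝ)⁻¹ ^ p) (by positivity) h1.det_pos.ne',
      Real.log_mul (x := N₀.det ^ 2) (pow_ne_zero 2 hN₀d) h1.det_pos.ne']
    ring
  have iTr : Integrable (fun ω => trainErr R (R *ᵥ β₀) (X ω) (y ω)) P :=
    (((iL.const_mul n).add (iD.const_mul n)).add (integrable_const _)).congr htr.symm
  -- the optimism
  have hopt : (fun ω => optimism P' X' y' R (R *ᵥ β₀) (X ω) (y ω)) =ᵐ[P] fun ω =>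
      n ^ 2 * (olsRss (X ω * N) (e ω))⁻¹
        + n ^ 2 * ((∑ j, betaFull (X ω * N) (e ω) j ^ 2) * (olsRss (X ω * N) (e ω))⁻¹)
        + n ^ 2 * (((X ω * N₀)ᵀ * (X ω * N₀))⁻¹).trace - n * (p + 1) := by
    filter_upwards [hpd, hrpos] with ω h1 h2
    rw [optimism, hy, trainErr_eq hn0 h1 hR hRN hN hker β₀ _ (hrpos' ω h2),
      testErr_eq hnew hS₀ hσ₀ hn0 h1 hR hRN hN hker β₀ _ (hrpos' ω h2) hN₀]
    have e1 : ∑ j, betaFull (X ω * N) (√σ₀sq • e ω) j ^ 2 =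
        σ₀sq * ∑ j, betaFull (X ω * N) (e ω) j ^ 2 := by
      rw [Finset.mul_sum]
      refine Finset.sum_congr rfl fun j _ => ?_
      rw [betaFull_smul, Pi.smul_apply, smul_eq_mul, mul_pow, hsq]
    -- Numerator and RSS both scale by σ₀², so the optimism is free of the error variance.
    have e2 : (n : ℝ) ^ 2 * (σ₀sq + ∑ j, betaFull (X ω * N) (√σ₀sq • e ω) j ^ 2) *
        (olsRss (X ω * N) (√σ₀sq • e ω))⁻¹ = n ^ 2 * (olsRss (X ω * N) (e ω))⁻¹
        + n ^ 2 * ((∑ j, betaFull (X ω * N) (e ω) j ^ 2) * (olsRss (X ω * N) (e ω))⁻¹) := by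
      rw [e1, olsRss_smul, hsq]
      have := h2.ne'
      field_simp
    rw [e2]
    ring
  have iO₁ := (iI.const_mul ((n : ℝ) ^ 2)).add (iB.const_mul ((n : ℝ) ^ 2))
  have iO₂ := iO₁.add (iT.const_mul ((n : ℝ) ^ 2))
  have iOpt : Integrable (fun ω => optimism P' X' y' R (R *ᵥ β₀) (X ω) (y ω)) P :=
    (iO₂.sub (integrable_const _)).congr hopt.symm
  have mOpt : ∫ ω, optimism P' X' y' R (R *ᵥ β₀) (X ω) (y ω) ∂P =
      n * ((n * (n - 1)) / (((n : ℝ) - p + m - 2) * ((n : ℝ) - p + m - 1)))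
        + n * ((n * p) / ((n : ℝ) - p - 1)) - n * (p + 1) := by
    rw [integral_congr_ae hopt, integral_sub (by exact iO₂) (integrable_const _),
      integral_add (by exact iO₁) (iT.const_mul _), integral_add (iI.const_mul _) (iB.const_mul _),
      integral_const_mul, integral_const_mul, integral_const_mul, mI, mB, mT, integral_const,
      probReal_univ, one_smul, show (n : ℝ) - p + m - 2 = n - q - 2 by rw [hqR]; ring,
      show (n : ℝ) - p + m - 1 = n - q - 1 by rw [hqR]; ring]
    -- The first two terms combine because 1 + q/(n-q-1) = (n-1)/(n-q-1).
    have h1 : (n : ℝ) - q - 2 ≠ 0 := by linarith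
    have h2 : (n : ℝ) - q - 1 ≠ 0 := by linarith
    have h3 : (n : ℝ) - p - 1 ≠ 0 := by linarith
    field_simp
    ring
  -- The test error is optimism plus training error, so its integrability needs no separate bound.
  have iTe : Integrable (fun ω => testErr P' X' y' R (R *ᵥ β₀) (X ω) (y ω)) P :=
    (iOpt.add iTr).congr (ae_of_all _ fun ω => by simp [optimism])
  -- the criterion
  have hcrit : ∀ᵐ ω ∂P, trainErr R (R *ᵥ β₀) (X ω) (y ω) +
      ∫ ω₁, optimism P' X' y' R (R *ᵥ β₀) (X ω₁) (y ω₁) ∂P =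
      raicc R (R *ᵥ β₀) (X ω) (y ω) + restrictionFree (X ω) := by
    filter_upwards [hpd, hrpos] with ω h1 h2
    rw [mOpt, hy, trainErr_eq hn0 h1 hR hRN hN hker β₀ _ (hrpos' ω h2), raicc, restrictionFree,
      rss_eq h1 hR hRN hN hker β₀, Real.log_mul (by positivity)
        (div_pos (hrpos' ω h2) hnR).ne']
    ring
  have iCrit : Integrable (fun ω => raicc R (R *ᵥ β₀) (X ω) (y ω) + restrictionFree (X ω)) P :=
    (iTr.add (integrable_const _)).congr hcrit
  refine ⟨?_, ?_, iTe, iTr, mOpt, hcrit, iCrit, ?_⟩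
  · filter_upwards [hpd, hrpos] with ω h1 h2 θ
    rw [hy]
    exact isRestrictedMLE_iff hn0 h1 hR hRN hN hker β₀ _ (hrpos' ω h2) θ
  · filter_upwards [hpd, hrpos] with ω h1 h2
    rw [hy]
    obtain ⟨h3, h4⟩ := mle_mem hn0 h1 hR hRN hN hker β₀ _ (hrpos' ω h2)
    exact (hnew.integral_negTwoLogLik hS₀ hσ₀ β₀ _ h3 h4).1
  · rw [← integral_congr_ae hcrit, integral_add iTr (integrable_const _), integral_const,
      probReal_univ, one_smul, ← integral_add iTr iOpt]
    exact integral_congr_ae (ae_of_all _ fun ω => by simp [optimism])
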